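/- All algebras are complex, associative, and not necessarily unital. An algebra $A$ is non-degenerate if $aA=0$ or $Aa=0$ implies $a=0$, and idempotent if $AA=A$ (products of subspaces denote linear spans). Let $A$ be a non-degenerate, idempotent algebra with multiplier algebra $M(A)$, let $B,C\subseteq M(A)$ be commuting subalgebras with $BA=A=CA$ and $AB=A=AC$, and let $S_B\colon B\to C$ and $S_C\colon C\to B$ be anti-isomorphisms. Write * ${}_BA\otimes A^B$ for the quotient of $A\otimes A$ by all $xa\otimes b-a\otimes S_B(x)b$ ($x\in B$), * ${}^CA\otimes A_C$ for the quotient by all $aS_C(y)\otimes b-a\otimes by$ ($y\in C$), * for $D\in\{B,C\}$, ${}_DA\otimes A_D$ for the quotient by all $za\otimes b-a\otimes bz$, and $A_D\otimes{}_DA$ for the quotient by all $az\otimes b-a\otimes zb$ ($z\in D$). Assume that ${}_BA\otimes A^B$ is non-degenerate as a right module over $A\otimes1$ and over $1\otimes A$, and that ${}^CA\otimes A_C$ is non-degenerate as a left module over $A\otimes1$ and over $1\otimes A$. Let $\Delta_B$ be a homomorphism from $A$ to the algebra of those endomorphisms $T$ of ${}_BA\otimes A^B$ for which there are elements $T(a\otimes1),T(1\otimes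 b)\in{}_BA\otimes A^B$ with $T(a\otimes b)=T(a\otimes1)(1\otimes b)=T(1\otimes b)(a\otimes1)$ for all $a,b\in A$. Let $\Delta_C$ be a homomorphism from $A$ to the algebra of those endomorphisms $T$ of ${}^CA\otimes A_C$, acting from the right, for which there are elements $(a\otimes1)T,(1\otimes b)T\in{}^CA\otimes A_C$ with $(a\otimes b)T=(1\otimes b)((a\otimes1)T)=(a\otimes1)((1\otimes b)T)$ for all $a,b\in A$. Then $\mathcal A=(A,B,C,S_B,S_C,\Delta_B,\Delta_C)$ is called a multiplier bialgebroid if $$\Delta_B(xyax'y')=(y\otimes x)\Delta_B(a)(y'\otimes x'),\qquad \Delta_C(xyax'y')=(y\otimes x)\Delta_C(a)(y'\otimes x')$$ for all $a\in A$, $x,x'\in B$, $y,y'\in C$, and, for all $a,b,c\in A$, $$(\Delta_B\otimes\iota)(\Delta_B(b)(1\otimes c))(a\otimes1\otimes1)=(\iota\otimes\Delta_B)(\Delta_B(b)(a\otimes1))(1\otimes1\otimes c),$$ $$(a\otimes1\otimes1)((\Delta_C\otimes\iota)((1\otimes c)\Delta_C(b)))=(1\otimes1\otimes c)((\iota\otimes\Delta_C)((a\otimes1)\Delta_C(b))),$$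 $$((\Delta_B\otimes\iota)((1\otimes c)\Delta_C(b)))(a\otimes1\otimes1)=(1\otimes1\otimes c)((\iota\otimes\Delta_C)(\Delta_B(b)(a\otimes1))),$$ $$(a\otimes1\otimes1)((\Delta_C\otimes\iota)(\Delta_B(b)(1\otimes c)))=((\iota\otimes\Delta_B)((a\otimes1)\Delta_C(b)))(1\otimes1\otimes c).$$ The canonical maps of $\mathcal A$ are $$T_\lambda\colon{}_CA\otimes A_C\to{}_BA\otimes A^B,\ a\otimes b\mapsto\Delta_B(b)(a\otimes1),\qquad T_\rho\colon A_B\otimes{}_BA\to{}_BA\otimes A^B,\ a\otimes b\mapsto\Delta_B(a)(1\otimes b),$$ $${}_\lambda T\colon A_C\otimes{}_CA\to{}^CA\otimes A_C,\ a\otimes b\mapsto(a\otimes1)\Delta_C(b),\qquad {}_\rho T\colon{}_BA\otimes A_B\to{}^CA\otimes A_C,\ a\otimes b\mapsto(1\otimes b)\Delta_C(a).$$ Assume that $\mathcal A$ is a regular multiplier Hopf algebroid. This means that the four canonical maps are bijective and that $$S_B({}_BI)A=I^BA=A\,S_C(I_C)=A\,({}^CI)=A,$$ where ${}_BI,I^B\subseteq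 B$ are the spans of all values $\omega(a)$ of linear maps $\omega\colon A\to B$ satisfying $\omega(xa)=x\omega(a)$, respectively $\omega(S_B(x)a)=\omega(a)x$, and $I_C,{}^CI\subseteq C$ are the spans of all values of linear maps $\omega\colon A\to C$ satisfying $\omega(ay)=\omega(a)y$, respectively $\omega(aS_C(y))=y\omega(a)$. A left counit of $\mathcal A$ is a linear map $\varepsilon_B\colon A\to B$ with $\varepsilon_B(xa)=x\varepsilon_B(a)$, $\varepsilon_B(S_B(x)a)=\varepsilon_B(a)x$ and $(\varepsilon_B\otimes\iota)T_\rho(a\otimes b)=ab$, $(\iota\otimes\varepsilon_B)T_\lambda(a\otimes b)=ba$, where $(\varepsilon_B\otimes\iota)(a\otimes b)=S_B(\varepsilon_B(a))b$ and $(\iota\otimes\varepsilon_B)(a\otimes b)=\varepsilon_B(b)a$. A right counit of $\mathcal A$ is a linear map $\varepsilon_C\colon A\to C$ with $\varepsilon_C(ay)=\varepsilon_C(a)y$, $\varepsilon_C(aS_C(y))=y\varepsilon_C(a)$ and $(\varepsilon_C\otimes\iota){}_\rho T(a\otimes b)=ba$, $(\iota\otimes\varepsilon_C){}_\lambda T(a\otimes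 b)=ab$, where $(\varepsilon_C\otimes\iota)(a\otimes b)=b\varepsilon_C(a)$ and $(\iota\otimes\varepsilon_C)(a\otimes b)=aS_C(\varepsilon_C(b))$. Let $S$ be an invertible antipode of $\mathcal A$, that is, an anti-automorphism of the algebra $A$ such that $S(xyax'y')=S_C(y')S_B(x')S(a)S_C(y)S_B(x)$ for all $x,x'\in B$, $y,y'\in C$, $a\in A$, and such that there are a left counit $\varepsilon_B\colon A\to B$ and a right counit $\varepsilon_C\colon A\to C$ of $\mathcal A$ with $$m\,(S\otimes\iota)\,T_\rho(a\otimes b)=S_C(\varepsilon_C(a))\,b,\qquad m\,(\iota\otimes S)\,{}_\lambda T(a\otimes b)=a\,S_B(\varepsilon_B(b))\qquad(a,b\in A),$$ where $m$ denotes multiplication. Then $\Sigma(S\otimes S)\colon a\otimes b\mapsto S(b)\otimes S(a)$ gives well-defined linear maps $${}_CA\otimes A_C\to{}_BA\otimes A_B,\quad {}_BA\otimes A^B\to{}^CA\otimes A_C,\quad A_C\otimes{}_CA\to A_B\otimes{}_BA,\quad {}^CA\otimes A_C\to{}_BA\otimes A^B,$$ and $${}_\rho T\circ\Sigma(S\otimes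 S)=\Sigma(S\otimes S)\circ T_\lambda\quad\text{on }{}_CA\otimes A_C,\qquad T_\rho\circ\Sigma(S\otimes S)=\Sigma(S\otimes S)\circ{}_\lambda T\quad\text{on }A_C\otimes{}_CA.$$ -/

import Mathlib

open scoped TensorProduct

set_option linter.unusedSectionVars false

noncomputable section

namespace MultHopf

/-! ### Multipliers -/

section Multipliers

variable (A : Type*) [NonUnitalRing A] [Module ℂ A] [IsScalarTower ℂ A A] [SMulCommClass ℂ A A]

/-- The multiplier algebra `M(A)`: pairs consisting of a left multiplier `L` (`a ↦ T a`) and a right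
multiplier `R` (`a ↦ a T`) of `A` such that `a (T b) = (a T) b`. Products are formed so that
`(T T') a = T (T' a)` and `a (T T') = (a T) T'`. If `A` is non-degenerate as a right module over
itself, `R` is determined by `L`, and this is the algebra of all `L ∈ End(A_A)` with `A L ⊆ A`;
similarly on the other side. -/
def multiplierAlgebra : Subalgebra ℂ (Module.End ℂ A × (Module.End ℂ A)ᵐᵒᵖ) where
  carrier := {T | (∀ a b : A, T.1 (a * b) = T.1 a * b) ∧
    (∀ a b : A, T.2.unop (a * b) = a * T.2.unop b) ∧
    (∀ a b : A, a * T.1 b = T.2.unop a * b)}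
  mul_mem' := by
    rintro T T' ⟨h1, h2, h3⟩ ⟨k1, k2, k3⟩
    refine ⟨fun a b => ?_, fun a b => ?_, fun a b => ?_⟩
    · simp [k1, h1]
    · simp [k2, h2]
    · simp [h3, k3]
  add_mem' := by
    rintro T T' ⟨h1, h2, h3⟩ ⟨k1, k2, k3⟩
    refine ⟨fun a b => ?_, fun a b => ?_, fun a b => ?_⟩
    · simp [k1, h1, add_mul]
    · simp [k2, h2, mul_add]
    · simp [h3, k3, add_mul, mul_add]
  algebraMap_mem' := by
    intro r
    refine ⟨fun a b => ?_, fun a b => ?_, fun a b => ?_⟩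
    · exact (smul_mul_assoc r a b).symm
    · exact (mul_smul_comm r a b).symm
    · exact (mul_smul_comm r a b).trans (smul_mul_assoc r a b).symm

/-- The multiplier algebra `M(A)` as a type. -/
def Multiplier : Type _ := multiplierAlgebra A

instance : Ring (Multiplier A) := inferInstanceAs (Ring (multiplierAlgebra A))

instance : Algebra ℂ (Multiplier A) := inferInstanceAs (Algebra ℂ (multiplierAlgebra A))

variable {A}

/-- `lm T a = T a`. -/
def lm : Multiplier A →ₗ[ℂ] Module.End ℂ A where
  toFun T := T.1.1
  map_add' _ _ := rfl
  map_smul' _ _ := rfl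

/-- `rm T a = a T`. -/
def rm : Multiplier A →ₗ[ℂ] Module.End ℂ A where
  toFun T := T.1.2.unop
  map_add' _ _ := rfl
  map_smul' _ _ := rfl

theorem lm_mul_right (T : Multiplier A) (a b : A) : lm T (a * b) = lm T a * b := T.2.1 a b

theorem rm_mul_left (T : Multiplier A) (a b : A) : rm T (a * b) = a * rm T b := T.2.2.1 a b

theorem mul_lm (T : Multiplier A) (a b : A) : a * lm T b = rm T a * b := T.2.2.2 a b

theorem lm_mul (T T' : Multiplier A) (a : A) : lm (T * T') a = lm T (lm T' a) := rfl

theorem rm_mul (T T' : Multiplier A) (a : A) : rm (T * T') a = rm T' (rm T a) := rfl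

end Multipliers

/-! ### Balanced tensor products -/

section Balanced

variable {A : Type*} [NonUnitalRing A] [Module ℂ A]
variable {ι κ : Type*}

/-- The span of all `f x a ⊗ b - a ⊗ g x b`. -/
def balancedRel (f g : ι → Module.End ℂ A) : Submodule ℂ (A ⊗[ℂ] A) :=
  Submodule.span ℂ {z | ∃ (x : ι) (a b : A), z = f x a ⊗ₜ[ℂ] b - a ⊗ₜ[ℂ] g x b}

/-- The tensor product of `A` with itself, balanced with respect to the actions `f` on the first and
`g` on the second factor. -/
def BalTensor (f g : ι → Module.End ℂ A) : Type _ := (A ⊗[ℂ] A) ⧸ balancedRel f g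

instance (f g : ι → Module.End ℂ A) : AddCommGroup (BalTensor f g) :=
  inferInstanceAs (AddCommGroup ((A ⊗[ℂ] A) ⧸ balancedRel f g))

instance (f g : ι → Module.End ℂ A) : Module ℂ (BalTensor f g) :=
  inferInstanceAs (Module ℂ ((A ⊗[ℂ] A) ⧸ balancedRel f g))

/-- The quotient map from `A ⊗ A` to a balanced tensor product. -/
def BalTensor.proj (f g : ι → Module.End ℂ A) : A ⊗[ℂ] A →ₗ[ℂ] BalTensor f g :=
  (balancedRel f g).mkQ

/-- The class of `a ⊗ b` in a balanced tensor product. -/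
def BalTensor.tmul (f g : ι → Module.End ℂ A) (a b : A) : BalTensor f g :=
  BalTensor.proj f g (a ⊗ₜ[ℂ] b)

theorem BalTensor.tmul_balanced (f g : ι → Module.End ℂ A) (x : ι) (a b : A) :
    BalTensor.tmul f g (f x a) b = BalTensor.tmul f g a (g x b) :=
  (Submodule.Quotient.eq _).2 (Submodule.subset_span ⟨x, a, b, rfl⟩)

/-- The linear map out of a balanced tensor product induced by a balanced bilinear map. -/
def BalTensor.lift {M : Type*} [AddCommGroup M] [Module ℂ M] {f g : ι → Module.End ℂ A}
    (F : A →ₗ[ℂ] A →ₗ[ℂ] M) (hF : ∀ x a b, F (f x a) b = F a (g x b)) :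
    BalTensor f g →ₗ[ℂ] M :=
  (balancedRel f g).liftQ (TensorProduct.lift F) (by
    refine Submodule.span_le.2 ?_
    rintro _ ⟨x, a, b, rfl⟩
    simp [hF])

@[simp]
theorem BalTensor.lift_tmul {M : Type*} [AddCommGroup M] [Module ℂ M] {f g : ι → Module.End ℂ A}
    (F : A →ₗ[ℂ] A →ₗ[ℂ] M) (hF : ∀ x a b, F (f x a) b = F a (g x b)) (a b : A) :
    BalTensor.lift F hF (BalTensor.tmul f g a b) = F a b :=
  TensorProduct.lift.tmul a b

theorem BalTensor.hom_ext {M : Type*} [AddCommGroup M] [Module ℂ M] {f g : ι → Module.End ℂ A}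
    {F G : BalTensor f g →ₗ[ℂ] M}
    (h : ∀ a b, F (BalTensor.tmul f g a b) = G (BalTensor.tmul f g a b)) : F = G :=
  Submodule.linearMap_qext _ (TensorProduct.ext' h)

/-- The canonical bilinear map `(a, b) ↦ a ⊗ b` to a balanced tensor product. -/
def BalTensor.mk₂ (f g : ι → Module.End ℂ A) : A →ₗ[ℂ] A →ₗ[ℂ] BalTensor f g :=
  (TensorProduct.mk ℂ A A).compr₂ (BalTensor.proj f g)

@[simp]
theorem BalTensor.mk₂_apply (f g : ι → Module.End ℂ A) (a b : A) :
    BalTensor.mk₂ f g a b = BalTensor.tmul f g a b := rfl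

theorem BalTensor.add_tmul (f g : ι → Module.End ℂ A) (a a' b : A) :
    BalTensor.tmul f g (a + a') b = BalTensor.tmul f g a b + BalTensor.tmul f g a' b :=
  LinearMap.map_add₂ (BalTensor.mk₂ f g) a a' b

theorem BalTensor.tmul_add (f g : ι → Module.End ℂ A) (a b b' : A) :
    BalTensor.tmul f g a (b + b') = BalTensor.tmul f g a b + BalTensor.tmul f g a b' :=
  map_add (BalTensor.mk₂ f g a) b b'

theorem BalTensor.smul_tmul (f g : ι → Module.End ℂ A) (r : ℂ) (a b : A) :
    BalTensor.tmul f g (r • a) b = r • BalTensor.tmul f g a b :=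
  LinearMap.map_smul₂ (BalTensor.mk₂ f g) r a b

theorem BalTensor.tmul_smul (f g : ι → Module.End ℂ A) (r : ℂ) (a b : A) :
    BalTensor.tmul f g a (r • b) = r • BalTensor.tmul f g a b :=
  map_smul (BalTensor.mk₂ f g a) r b

/-- The endomorphism `a ⊗ b ↦ F a ⊗ G b` of a balanced tensor product, for `F`, `G` commuting with
the respective actions. -/
def BalTensor.map {f g : ι → Module.End ℂ A} (F G : Module.End ℂ A)
    (hF : ∀ x a, F (f x a) = f x (F a)) (hG : ∀ x b, G (g x b) = g x (G b)) :
    Module.End ℂ (BalTensor f g) :=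
  BalTensor.lift ((BalTensor.mk₂ f g).compl₁₂ F G) (by
    intro x a b
    simp [hF, hG, BalTensor.tmul_balanced])

@[simp]
theorem BalTensor.map_tmul {f g : ι → Module.End ℂ A} (F G : Module.End ℂ A)
    (hF : ∀ x a, F (f x a) = f x (F a)) (hG : ∀ x b, G (g x b) = g x (G b)) (a b : A) :
    BalTensor.map F G hF hG (BalTensor.tmul f g a b) = BalTensor.tmul f g (F a) (G b) := by
  simp [BalTensor.map]

/-- The subspace of relations of a threefold tensor product that is balanced with respect to `f`, `g`
in the first two and to `f₂`, `g₂` in the last two factors. -/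
def balancedRel₃ (f g : ι → Module.End ℂ A) (f₂ g₂ : κ → Module.End ℂ A) :
    Submodule ℂ (A ⊗[ℂ] (A ⊗[ℂ] A)) :=
  Submodule.span ℂ
    ({z | ∃ (x : ι) (a b c : A), z = f x a ⊗ₜ[ℂ] (b ⊗ₜ[ℂ] c) - a ⊗ₜ[ℂ] (g x b ⊗ₜ[ℂ] c)} ∪
     {z | ∃ (y : κ) (a b c : A), z = a ⊗ₜ[ℂ] (f₂ y b ⊗ₜ[ℂ] c) - a ⊗ₜ[ℂ] (b ⊗ₜ[ℂ] g₂ y c)})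

/-- The threefold balanced tensor product. -/
def BalTensor₃ (f g : ι → Module.End ℂ A) (f₂ g₂ : κ → Module.End ℂ A) : Type _ :=
  (A ⊗[ℂ] (A ⊗[ℂ] A)) ⧸ balancedRel₃ f g f₂ g₂

instance (f g : ι → Module.End ℂ A) (f₂ g₂ : κ → Module.End ℂ A) :
    AddCommGroup (BalTensor₃ f g f₂ g₂) :=
  inferInstanceAs (AddCommGroup ((A ⊗[ℂ] (A ⊗[ℂ] A)) ⧸ balancedRel₃ f g f₂ g₂))

instance (f g : ι → Module.End ℂ A) (f₂ g₂ : κ → Module.End ℂ A) :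
    Module ℂ (BalTensor₃ f g f₂ g₂) :=
  inferInstanceAs (Module ℂ ((A ⊗[ℂ] (A ⊗[ℂ] A)) ⧸ balancedRel₃ f g f₂ g₂))

/-- The quotient map from `A ⊗ A ⊗ A` to a threefold balanced tensor product. -/
def BalTensor₃.proj (f g : ι → Module.End ℂ A) (f₂ g₂ : κ → Module.End ℂ A) :
    A ⊗[ℂ] (A ⊗[ℂ] A) →ₗ[ℂ] BalTensor₃ f g f₂ g₂ :=
  (balancedRel₃ f g f₂ g₂).mkQ

/-- The trilinear map `(a, b, c) ↦ a ⊗ b ⊗ c` to the threefold balanced tensor product. -/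
def BalTensor₃.mk₃ (f g : ι → Module.End ℂ A) (f₂ g₂ : κ → Module.End ℂ A) :
    A →ₗ[ℂ] A →ₗ[ℂ] A →ₗ[ℂ] BalTensor₃ f g f₂ g₂ where
  toFun a := (TensorProduct.mk ℂ A A).compr₂
    (BalTensor₃.proj f g f₂ g₂ ∘ₗ TensorProduct.mk ℂ A (A ⊗[ℂ] A) a)
  map_add' a a' := by
    rw [map_add, LinearMap.comp_add]
    rfl
  map_smul' r a := by
    rw [map_smul, LinearMap.comp_smul]
    rfl

theorem BalTensor₃.mk₃_balanced (f g : ι → Module.End ℂ A) (f₂ g₂ : κ → Module.End ℂ A) (x : ι)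
    (a b c : A) : BalTensor₃.mk₃ f g f₂ g₂ (f x a) b c = BalTensor₃.mk₃ f g f₂ g₂ a (g x b) c :=
  (Submodule.Quotient.eq _).2 (Submodule.subset_span (Or.inl ⟨x, a, b, c, rfl⟩))

theorem BalTensor₃.mk₃_balanced₂ (f g : ι → Module.End ℂ A) (f₂ g₂ : κ → Module.End ℂ A) (y : κ)
    (a b c : A) : BalTensor₃.mk₃ f g f₂ g₂ a (f₂ y b) c = BalTensor₃.mk₃ f g f₂ g₂ a b (g₂ y c) :=
  (Submodule.Quotient.eq _).2 (Submodule.subset_span (Or.inr ⟨y, a, b, c, rfl⟩))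

/-- The map `w ↦ (c ↦ w ⊗ c)`, where `w` lies in the tensor product of the first two factors. -/
def BalTensor₃.appendRight (f g : ι → Module.End ℂ A) (f₂ g₂ : κ → Module.End ℂ A) :
    BalTensor f g →ₗ[ℂ] A →ₗ[ℂ] BalTensor₃ f g f₂ g₂ :=
  BalTensor.lift (BalTensor₃.mk₃ f g f₂ g₂)
    (fun x a b => LinearMap.ext fun c => BalTensor₃.mk₃_balanced f g f₂ g₂ x a b c)

@[simp]
theorem BalTensor₃.appendRight_tmul (f g : ι → Module.End ℂ A) (f₂ g₂ : κ → Module.End ℂ A)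
    (a b c : A) :
    BalTensor₃.appendRight f g f₂ g₂ (BalTensor.tmul f g a b) c =
      BalTensor₃.mk₃ f g f₂ g₂ a b c := by
  simp [BalTensor₃.appendRight]

/-- The map `a ↦ (w ↦ a ⊗ w)`, where `w` lies in the tensor product of the last two factors. -/
def BalTensor₃.appendLeft (f g : ι → Module.End ℂ A) (f₂ g₂ : κ → Module.End ℂ A) :
    A →ₗ[ℂ] BalTensor f₂ g₂ →ₗ[ℂ] BalTensor₃ f g f₂ g₂ where
  toFun a := BalTensor.lift (BalTensor₃.mk₃ f g f₂ g₂ a)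
    (fun y b c => BalTensor₃.mk₃_balanced₂ f g f₂ g₂ y a b c)
  map_add' a a' := BalTensor.hom_ext fun b c => by simp
  map_smul' r a := BalTensor.hom_ext fun b c => by simp

@[simp]
theorem BalTensor₃.appendLeft_tmul (f g : ι → Module.End ℂ A) (f₂ g₂ : κ → Module.End ℂ A)
    (a b c : A) :
    BalTensor₃.appendLeft f g f₂ g₂ a (BalTensor.tmul f₂ g₂ b c) =
      BalTensor₃.mk₃ f g f₂ g₂ a b c := by
  simp [BalTensor₃.appendLeft]

/-- Commutativity of the square
`(U ⊗ id) ∘ (id ⊗ V) = (id ⊗ V) ∘ (U ⊗ id)` of maps from `A ⊗ A ⊗ A` to the threefold balanced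
tensor product, for bilinear maps `U`, `V` from `A × A` to balanced tensor products. Here
`V b c` and `U a b` are represented by tensors `v` and `u` in `A ⊗ A`, to which the second map is
applied factor by factor. In all applications below, `U` and `V` are compatible with the actions used
for the balancing, so that the result does not depend on the representatives. -/
def Coassociative {f g : ι → Module.End ℂ A} {f₂ g₂ : κ → Module.End ℂ A}
    (U : A →ₗ[ℂ] A →ₗ[ℂ] BalTensor f g) (V : A →ₗ[ℂ] A →ₗ[ℂ] BalTensor f₂ g₂) : Prop :=
  ∀ (a b c : A) (u v : A ⊗[ℂ] A),
    BalTensor.proj f g u = U a b → BalTensor.proj f₂ g₂ v = V b c →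
    TensorProduct.lift ((BalTensor₃.appendRight f g f₂ g₂) ∘ₗ U a) v =
      TensorProduct.lift ((BalTensor₃.appendLeft f g f₂ g₂).compl₂ (V.flip c)) u

end Balanced

section OneSided

variable {A : Type*} [NonUnitalRing A] [Module ℂ A] [IsScalarTower ℂ A A] [SMulCommClass ℂ A A]
variable {B : Type*} [NonUnitalRing B] [Module ℂ B]

/-! ### Left multiplier bialgebroids -/

/-- The tensor product `_B A ⊗ A^B`, in which `s(x) a ⊗ b = a ⊗ t(x) b`. -/
abbrev LeftTensor (s t : B →ₗ[ℂ] Multiplier A) : Type _ :=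
  BalTensor (fun x => lm (s x)) (fun x => lm (t x))

/-- The map `w ↦ w (c ⊗ 1)` on `_B A ⊗ A^B`. -/
def LeftTensor.mulFst (s t : B →ₗ[ℂ] Multiplier A) (c : A) :
    Module.End ℂ (LeftTensor s t) :=
  BalTensor.map (LinearMap.mulRight ℂ c) LinearMap.id
    (fun x a => by simp [lm_mul_right]) (fun _ _ => rfl)

theorem LeftTensor.mulFst_tmul (s t : B →ₗ[ℂ] Multiplier A) (a b c : A) :
    LeftTensor.mulFst s t c (BalTensor.tmul _ _ a b) = BalTensor.tmul _ _ (a * c) b :=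
  BalTensor.map_tmul _ _ _ _ a b

/-- The map `w ↦ w (1 ⊗ c)` on `_B A ⊗ A^B`. -/
def LeftTensor.mulSnd (s t : B →ₗ[ℂ] Multiplier A) (c : A) :
    Module.End ℂ (LeftTensor s t) :=
  BalTensor.map LinearMap.id (LinearMap.mulRight ℂ c)
    (fun _ _ => rfl) (fun x a => by simp [lm_mul_right])

theorem LeftTensor.mulSnd_tmul (s t : B →ₗ[ℂ] Multiplier A) (a b c : A) :
    LeftTensor.mulSnd s t c (BalTensor.tmul _ _ a b) = BalTensor.tmul _ _ a (b * c) :=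
  BalTensor.map_tmul _ _ _ _ a b

/-- The standing assumptions on the algebras `A`, `B` and the maps `s`, `t` in a left multiplier
bialgebroid. -/
structure IsLeftBase (s t : B →ₗ[ℂ] Multiplier A) : Prop where
  nondegenerate : ∀ m : A, (∀ a : A, m * a = 0) → m = 0
  idempotent : Submodule.span ℂ {z : A | ∃ a b : A, z = a * b} = ⊤
  s_mul : ∀ x y, s (x * y) = s x * s y
  t_mul : ∀ x y, t (x * y) = t y * t x
  commute : ∀ x y, s x * t y = t y * s x
  s_faithful : ∀ x, (∀ a, lm (s x) a = 0) → x = 0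
  t_faithful : ∀ x, (∀ a, lm (t x) a = 0) → x = 0
  s_idempotent : Submodule.span ℂ {z : A | ∃ x a, z = lm (s x) a} = ⊤
  t_idempotent : Submodule.span ℂ {z : A | ∃ x a, z = lm (t x) a} = ⊤
  nondegenerate_fst : ∀ w : LeftTensor s t, (∀ a, LeftTensor.mulFst s t a w = 0) → w = 0
  nondegenerate_snd : ∀ w : LeftTensor s t, (∀ a, LeftTensor.mulSnd s t a w = 0) → w = 0

/-- The algebra of all endomorphisms `T` of `_B A ⊗ A^B` for which there are elements `T(a ⊗ 1)` and
`T(1 ⊗ b)` of `_B A ⊗ A^B` with `T(a ⊗ b) = T(a ⊗ 1)(1 ⊗ b) = T(1 ⊗ b)(a ⊗ 1)` for all `a`, `b`. -/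
def leftTakeuchi (s t : B →ₗ[ℂ] Multiplier A) :
    NonUnitalSubalgebra ℂ (Module.End ℂ (LeftTensor s t)) where
  carrier := {T |
    (∀ a, ∃ w : LeftTensor s t, ∀ b, T (BalTensor.tmul _ _ a b) = LeftTensor.mulSnd s t b w) ∧
    (∀ b, ∃ w : LeftTensor s t, ∀ a, T (BalTensor.tmul _ _ a b) = LeftTensor.mulFst s t a w)}
  add_mem' := by
    rintro T T' ⟨h1, h2⟩ ⟨k1, k2⟩
    refine ⟨fun a => ?_, fun b => ?_⟩
    · obtain ⟨w, hw⟩ := h1 a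
      obtain ⟨w', hw'⟩ := k1 a
      exact ⟨w + w', fun b => by simp [hw, hw']⟩
    · obtain ⟨w, hw⟩ := h2 b
      obtain ⟨w', hw'⟩ := k2 b
      exact ⟨w + w', fun b => by simp [hw, hw']⟩
  zero_mem' := ⟨fun a => ⟨0, by simp⟩, fun b => ⟨0, by simp⟩⟩
  smul_mem' := by
    rintro r T ⟨h1, h2⟩
    refine ⟨fun a => ?_, fun b => ?_⟩
    · obtain ⟨w, hw⟩ := h1 a
      exact ⟨r • w, fun b => by simp [hw]⟩
    · obtain ⟨w, hw⟩ := h2 b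
      exact ⟨r • w, fun b => by simp [hw]⟩
  mul_mem' := by
    rintro T T' ⟨h1, h2⟩ ⟨k1, k2⟩
    have c1 : ∀ b, T ∘ₗ LeftTensor.mulSnd s t b = LeftTensor.mulSnd s t b ∘ₗ T := by
      intro b
      refine BalTensor.hom_ext fun p q => ?_
      obtain ⟨w, hw⟩ := h1 p
      have e : LeftTensor.mulSnd s t (q * b) =
          LeftTensor.mulSnd s t b ∘ₗ LeftTensor.mulSnd s t q :=
        BalTensor.hom_ext fun p q => by simp [LeftTensor.mulSnd_tmul, mul_assoc]
      have e' : LeftTensor.mulSnd s t b (BalTensor.tmul _ _ p q) =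
          BalTensor.tmul _ _ p (q * b) := LeftTensor.mulSnd_tmul s t _ _ _
      simp only [LinearMap.comp_apply]
      rw [e', hw, hw, e, LinearMap.comp_apply]
    have c2 : ∀ b, T ∘ₗ LeftTensor.mulFst s t b = LeftTensor.mulFst s t b ∘ₗ T := by
      intro b
      refine BalTensor.hom_ext fun p q => ?_
      obtain ⟨w, hw⟩ := h2 q
      have e : LeftTensor.mulFst s t (p * b) =
          LeftTensor.mulFst s t b ∘ₗ LeftTensor.mulFst s t p :=
        BalTensor.hom_ext fun p q => by simp [LeftTensor.mulFst_tmul, mul_assoc]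
      have e' : LeftTensor.mulFst s t b (BalTensor.tmul _ _ p q) =
          BalTensor.tmul _ _ (p * b) q := LeftTensor.mulFst_tmul s t _ _ _
      simp only [LinearMap.comp_apply]
      rw [e', hw, hw, e, LinearMap.comp_apply]
    refine ⟨fun a => ?_, fun b => ?_⟩
    · obtain ⟨w, hw⟩ := k1 a
      refine ⟨T w, fun b => ?_⟩
      rw [Module.End.mul_apply, hw]
      exact LinearMap.congr_fun (c1 b) w
    · obtain ⟨w, hw⟩ := k2 b
      refine ⟨T w, fun a => ?_⟩
      rw [Module.End.mul_apply, hw]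
      exact LinearMap.congr_fun (c2 a) w

section LeftBase

variable {s t : B →ₗ[ℂ] Multiplier A}

theorem IsLeftBase.ext_snd (h : IsLeftBase s t) {w w' : LeftTensor s t}
    (e : ∀ b, LeftTensor.mulSnd s t b w = LeftTensor.mulSnd s t b w') : w = w' :=
  sub_eq_zero.1 (h.nondegenerate_snd _ fun b => by rw [map_sub, e, sub_self])

theorem IsLeftBase.ext_fst (h : IsLeftBase s t) {w w' : LeftTensor s t}
    (e : ∀ b, LeftTensor.mulFst s t b w = LeftTensor.mulFst s t b w') : w = w' :=
  sub_eq_zero.1 (h.nondegenerate_fst _ fun b => by rw [map_sub, e, sub_self])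

/-- The element `T(a ⊗ 1)`. -/
def leftTakeuchi.evalFst (T : leftTakeuchi s t) (a : A) : LeftTensor s t := (T.2.1 a).choose

theorem leftTakeuchi.mulSnd_evalFst (T : leftTakeuchi s t) (a b : A) :
    LeftTensor.mulSnd s t b (leftTakeuchi.evalFst T a) = T.1 (BalTensor.tmul _ _ a b) :=
  ((T.2.1 a).choose_spec b).symm

/-- The map `(T, a) ↦ T(a ⊗ 1)`. -/
def IsLeftBase.evalFst (h : IsLeftBase s t) :
    leftTakeuchi s t →ₗ[ℂ] A →ₗ[ℂ] LeftTensor s t :=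
  LinearMap.mk₂ ℂ leftTakeuchi.evalFst
    (fun T T' a => h.ext_snd fun b => by
      rw [map_add]
      simp only [leftTakeuchi.mulSnd_evalFst]
      rfl)
    (fun r T a => h.ext_snd fun b => by
      rw [map_smul]
      simp only [leftTakeuchi.mulSnd_evalFst]
      rfl)
    (fun T a a' => h.ext_snd fun b => by
      rw [map_add]
      simp only [leftTakeuchi.mulSnd_evalFst, BalTensor.add_tmul, map_add])
    (fun r T a => h.ext_snd fun b => by
      rw [map_smul]
      simp only [leftTakeuchi.mulSnd_evalFst, BalTensor.smul_tmul, map_smul])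

theorem IsLeftBase.mulSnd_evalFst (h : IsLeftBase s t) (T : leftTakeuchi s t) (a b : A) :
    LeftTensor.mulSnd s t b (h.evalFst T a) = T.1 (BalTensor.tmul _ _ a b) :=
  leftTakeuchi.mulSnd_evalFst T a b

/-- The element `T(1 ⊗ b)`. -/
def leftTakeuchi.evalSnd (T : leftTakeuchi s t) (b : A) : LeftTensor s t := (T.2.2 b).choose

theorem leftTakeuchi.mulFst_evalSnd (T : leftTakeuchi s t) (a b : A) :
    LeftTensor.mulFst s t a (leftTakeuchi.evalSnd T b) = T.1 (BalTensor.tmul _ _ a b) :=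
  ((T.2.2 b).choose_spec a).symm

/-- The map `(T, b) ↦ T(1 ⊗ b)`. -/
def IsLeftBase.evalSnd (h : IsLeftBase s t) :
    leftTakeuchi s t →ₗ[ℂ] A →ₗ[ℂ] LeftTensor s t :=
  LinearMap.mk₂ ℂ leftTakeuchi.evalSnd
    (fun T T' b => h.ext_fst fun a => by
      rw [map_add]
      simp only [leftTakeuchi.mulFst_evalSnd]
      rfl)
    (fun r T b => h.ext_fst fun a => by
      rw [map_smul]
      simp only [leftTakeuchi.mulFst_evalSnd]
      rfl)
    (fun T b b' => h.ext_fst fun a => by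
      rw [map_add]
      simp only [leftTakeuchi.mulFst_evalSnd, BalTensor.tmul_add, map_add])
    (fun r T b => h.ext_fst fun a => by
      rw [map_smul]
      simp only [leftTakeuchi.mulFst_evalSnd, BalTensor.tmul_smul, map_smul])

theorem IsLeftBase.mulFst_evalSnd (h : IsLeftBase s t) (T : leftTakeuchi s t) (a b : A) :
    LeftTensor.mulFst s t a (h.evalSnd T b) = T.1 (BalTensor.tmul _ _ a b) :=
  leftTakeuchi.mulFst_evalSnd T a b

/-- Left multiplication by `t(y) ⊗ 1` on `_B A ⊗ A^B`. -/
def IsLeftBase.actT (h : IsLeftBase s t) (y : B) : Module.End ℂ (LeftTensor s t) :=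
  BalTensor.map (lm (t y)) LinearMap.id
    (fun x a => by rw [← lm_mul, ← h.commute, lm_mul]) (fun _ _ => rfl)

/-- Left multiplication by `1 ⊗ s(x)` on `_B A ⊗ A^B`. -/
def IsLeftBase.actS (h : IsLeftBase s t) (x : B) : Module.End ℂ (LeftTensor s t) :=
  BalTensor.map LinearMap.id (lm (s x))
    (fun _ _ => rfl) (fun y a => by rw [← lm_mul, h.commute, lm_mul])

/-- The map `(a, b) ↦ Δ(b)(a ⊗ 1)`. -/
def IsLeftBase.preTlam (h : IsLeftBase s t) (Δ : A →ₙₐ[ℂ] leftTakeuchi s t) :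
    A →ₗ[ℂ] A →ₗ[ℂ] LeftTensor s t :=
  (h.evalFst ∘ₗ (Δ : A →ₗ[ℂ] leftTakeuchi s t)).flip

/-- The map `(a, b) ↦ Δ(a)(1 ⊗ b)`. -/
def IsLeftBase.preTrho (h : IsLeftBase s t) (Δ : A →ₙₐ[ℂ] leftTakeuchi s t) :
    A →ₗ[ℂ] A →ₗ[ℂ] LeftTensor s t :=
  h.evalSnd ∘ₗ (Δ : A →ₗ[ℂ] leftTakeuchi s t)

end LeftBase

/-- `(A, B, s, t, Δ)` is a left multiplier bialgebroid. The four fields `Δ_...` are the bilinearity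
condition `Δ(s(x) t(y) a s(x') t(y')) = (t(y) ⊗ s(x)) Δ(a) (t(y') ⊗ s(x'))`, spelled out for one
factor at a time. -/
structure IsLeftMultiplierBialgebroid (s t : B →ₗ[ℂ] Multiplier A)
    (Δ : A →ₙₐ[ℂ] leftTakeuchi s t) : Prop extends IsLeftBase s t where
  Δ_s_left : ∀ x a, (Δ (lm (s x) a)).1 = toIsLeftBase.actS x * (Δ a).1
  Δ_t_left : ∀ y a, (Δ (lm (t y) a)).1 = toIsLeftBase.actT y * (Δ a).1
  Δ_s_right : ∀ x a, (Δ (rm (s x) a)).1 = (Δ a).1 * toIsLeftBase.actS x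
  Δ_t_right : ∀ y a, (Δ (rm (t y) a)).1 = (Δ a).1 * toIsLeftBase.actT y
  coassoc : Coassociative (toIsLeftBase.preTlam Δ) (toIsLeftBase.preTrho Δ)

namespace IsLeftMultiplierBialgebroid

variable {s t : B →ₗ[ℂ] Multiplier A} {Δ : A →ₙₐ[ℂ] leftTakeuchi s t}

theorem preTlam_balanced (h : IsLeftMultiplierBialgebroid s t Δ) (x : B) (a b : A) :
    h.preTlam Δ (lm (t x) a) b = h.preTlam Δ a (rm (t x) b) := by
  refine h.ext_snd fun c => ?_
  refine (h.mulSnd_evalFst (Δ b) (lm (t x) a) c).trans ?_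
  refine Eq.trans ?_ (h.mulSnd_evalFst (Δ (rm (t x) b)) a c).symm
  rw [h.Δ_t_right]
  simp [IsLeftBase.actT]

/-- The canonical map `T_λ : A^B ⊗ ^B A → _B A ⊗ A^B`, `a ⊗ b ↦ Δ(b)(a ⊗ 1)`, where
`t(x) a ⊗ b = a ⊗ b t(x)` in the domain. -/
def Tlam (h : IsLeftMultiplierBialgebroid s t Δ) :
    BalTensor (fun x => lm (t x)) (fun x => rm (t x)) →ₗ[ℂ] LeftTensor s t :=
  BalTensor.lift (h.preTlam Δ) h.preTlam_balanced

theorem preTrho_balanced (h : IsLeftMultiplierBialgebroid s t Δ) (x : B) (a b : A) :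
    h.preTrho Δ (rm (s x) a) b = h.preTrho Δ a (lm (s x) b) := by
  refine h.ext_fst fun c => ?_
  refine (h.mulFst_evalSnd (Δ (rm (s x) a)) c b).trans ?_
  refine Eq.trans ?_ (h.mulFst_evalSnd (Δ a) c (lm (s x) b)).symm
  rw [h.Δ_s_right]
  simp [IsLeftBase.actS]

/-- The canonical map `T_ρ : A_B ⊗ _B A → _B A ⊗ A^B`, `a ⊗ b ↦ Δ(a)(1 ⊗ b)`, where
`a s(x) ⊗ b = a ⊗ s(x) b` in the domain. -/
def Trho (h : IsLeftMultiplierBialgebroid s t Δ) :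
    BalTensor (fun x => rm (s x)) (fun x => lm (s x)) →ₗ[ℂ] LeftTensor s t :=
  BalTensor.lift (h.preTrho Δ) h.preTrho_balanced

end IsLeftMultiplierBialgebroid

/-- The slice map `φ ⊗ id : _B A ⊗ A^B → A`, `a ⊗ b ↦ t(φ(a)) b`. -/
def IsLeftBase.sliceFst {s t : B →ₗ[ℂ] Multiplier A} (h : IsLeftBase s t) (φ : A →ₗ[ℂ] B)
    (hφ : ∀ x a, φ (lm (s x) a) = x * φ a) : LeftTensor s t →ₗ[ℂ] A :=
  BalTensor.lift
    (LinearMap.mk₂ ℂ (fun a b => lm (t (φ a)) b)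
      (fun a a' b => by simp) (fun r a b => by simp)
      (fun a b b' => by simp) (fun r a b => by simp))
    (fun x a b => by simp [hφ, h.t_mul, lm_mul])

/-- The slice map `id ⊗ ψ : _B A ⊗ A^B → A`, `a ⊗ b ↦ s(ψ(b)) a`. -/
def IsLeftBase.sliceSnd {s t : B →ₗ[ℂ] Multiplier A} (h : IsLeftBase s t) (ψ : A →ₗ[ℂ] B)
    (hψ : ∀ x a, ψ (lm (t x) a) = ψ a * x) : LeftTensor s t →ₗ[ℂ] A :=
  BalTensor.lift
    (LinearMap.mk₂ ℂ (fun a b => lm (s (ψ b)) a)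
      (fun a a' b => by simp) (fun r a b => by simp)
      (fun a b b' => by simp) (fun r a b => by simp))
    (fun x a b => by simp [hψ, h.s_mul, lm_mul])

/-- `ε` is a left counit. -/
structure IsLeftCounit {s t : B →ₗ[ℂ] Multiplier A} {Δ : A →ₙₐ[ℂ] leftTakeuchi s t}
    (h : IsLeftMultiplierBialgebroid s t Δ) (ε : A →ₗ[ℂ] B) : Prop where
  map_s : ∀ x a, ε (lm (s x) a) = x * ε a
  map_t : ∀ y a, ε (lm (t y) a) = ε a * y
  slice_Trho : ∀ a b, h.sliceFst ε map_s (h.Trho (BalTensor.tmul _ _ a b)) = a * b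
  slice_Tlam : ∀ a b, h.sliceSnd ε map_t (h.Tlam (BalTensor.tmul _ _ a b)) = b * a

/-! ### Right multiplier bialgebroids -/

/-- The tensor product `^C A ⊗ A_C`, in which `a t(y) ⊗ b = a ⊗ b s(y)`. -/
abbrev RightTensor (s t : B →ₗ[ℂ] Multiplier A) : Type _ :=
  BalTensor (fun x => rm (t x)) (fun x => rm (s x))

/-- The map `w ↦ (c ⊗ 1) w` on `^C A ⊗ A_C`. -/
def RightTensor.mulFst (s t : B →ₗ[ℂ] Multiplier A) (c : A) :
    Module.End ℂ (RightTensor s t) :=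
  BalTensor.map (LinearMap.mulLeft ℂ c) LinearMap.id
    (fun x a => by simp [rm_mul_left]) (fun _ _ => rfl)

theorem RightTensor.mulFst_tmul (s t : B →ₗ[ℂ] Multiplier A) (a b c : A) :
    RightTensor.mulFst s t c (BalTensor.tmul _ _ a b) = BalTensor.tmul _ _ (c * a) b :=
  BalTensor.map_tmul _ _ _ _ a b

/-- The map `w ↦ (1 ⊗ c) w` on `^C A ⊗ A_C`. -/
def RightTensor.mulSnd (s t : B →ₗ[ℂ] Multiplier A) (c : A) :
    Module.End ℂ (RightTensor s t) :=
  BalTensor.map LinearMap.id (LinearMap.mulLeft ℂ c)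
    (fun _ _ => rfl) (fun x a => by simp [rm_mul_left])

theorem RightTensor.mulSnd_tmul (s t : B →ₗ[ℂ] Multiplier A) (a b c : A) :
    RightTensor.mulSnd s t c (BalTensor.tmul _ _ a b) = BalTensor.tmul _ _ a (c * b) :=
  BalTensor.map_tmul _ _ _ _ a b

/-- The standing assumptions on the algebras `A`, `C` and the maps `s`, `t` in a right multiplier
bialgebroid. -/
structure IsRightBase (s t : B →ₗ[ℂ] Multiplier A) : Prop where
  nondegenerate : ∀ m : A, (∀ a : A, a * m = 0) → m = 0
  idempotent : Submodule.span ℂ {z : A | ∃ a b : A, z = a * b} = ⊤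
  s_mul : ∀ x y, s (x * y) = s x * s y
  t_mul : ∀ x y, t (x * y) = t y * t x
  commute : ∀ x y, s x * t y = t y * s x
  s_faithful : ∀ x, (∀ a, rm (s x) a = 0) → x = 0
  t_faithful : ∀ x, (∀ a, rm (t x) a = 0) → x = 0
  s_idempotent : Submodule.span ℂ {z : A | ∃ x a, z = rm (s x) a} = ⊤
  t_idempotent : Submodule.span ℂ {z : A | ∃ x a, z = rm (t x) a} = ⊤
  nondegenerate_fst : ∀ w : RightTensor s t, (∀ a, RightTensor.mulFst s t a w = 0) → w = 0
  nondegenerate_snd : ∀ w : RightTensor s t, (∀ a, RightTensor.mulSnd s t a w = 0) → w = 0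

/-- The algebra of all endomorphisms `T` of `^C A ⊗ A_C`, acting from the right (so that
`w (T T') = (w T) T'`), for which there are elements `(a ⊗ 1)T` and `(1 ⊗ b)T` of `^C A ⊗ A_C` with
`(a ⊗ b)T = (1 ⊗ b)((a ⊗ 1)T) = (a ⊗ 1)((1 ⊗ b)T)` for all `a`, `b`. -/
def rightTakeuchi (s t : B →ₗ[ℂ] Multiplier A) :
    NonUnitalSubalgebra ℂ (Module.End ℂ (RightTensor s t))ᵐᵒᵖ where
  carrier := {T |
    (∀ a, ∃ w : RightTensor s t, ∀ b,
      T.unop (BalTensor.tmul _ _ a b) = RightTensor.mulSnd s t b w) ∧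
    (∀ b, ∃ w : RightTensor s t, ∀ a,
      T.unop (BalTensor.tmul _ _ a b) = RightTensor.mulFst s t a w)}
  add_mem' := by
    rintro T T' ⟨h1, h2⟩ ⟨k1, k2⟩
    refine ⟨fun a => ?_, fun b => ?_⟩
    · obtain ⟨w, hw⟩ := h1 a
      obtain ⟨w', hw'⟩ := k1 a
      exact ⟨w + w', fun b => by simp [hw, hw']⟩
    · obtain ⟨w, hw⟩ := h2 b
      obtain ⟨w', hw'⟩ := k2 b
      exact ⟨w + w', fun b => by simp [hw, hw']⟩
  zero_mem' := ⟨fun a => ⟨0, by simp⟩, fun b => ⟨0, by simp⟩⟩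
  smul_mem' := by
    rintro r T ⟨h1, h2⟩
    refine ⟨fun a => ?_, fun b => ?_⟩
    · obtain ⟨w, hw⟩ := h1 a
      exact ⟨r • w, fun b => by simp [hw]⟩
    · obtain ⟨w, hw⟩ := h2 b
      exact ⟨r • w, fun b => by simp [hw]⟩
  mul_mem' := by
    rintro T' T ⟨k1, k2⟩ ⟨h1, h2⟩
    have c1 : ∀ b, T.unop ∘ₗ RightTensor.mulSnd s t b = RightTensor.mulSnd s t b ∘ₗ T.unop := by
      intro b
      refine BalTensor.hom_ext fun p q => ?_
      obtain ⟨w, hw⟩ := h1 p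
      have e : RightTensor.mulSnd s t (b * q) =
          RightTensor.mulSnd s t b ∘ₗ RightTensor.mulSnd s t q :=
        BalTensor.hom_ext fun p q => by simp [RightTensor.mulSnd_tmul, mul_assoc]
      have e' : RightTensor.mulSnd s t b (BalTensor.tmul _ _ p q) =
          BalTensor.tmul _ _ p (b * q) := RightTensor.mulSnd_tmul s t _ _ _
      simp only [LinearMap.comp_apply]
      rw [e', hw, hw, e, LinearMap.comp_apply]
    have c2 : ∀ b, T.unop ∘ₗ RightTensor.mulFst s t b = RightTensor.mulFst s t b ∘ₗ T.unop := by
      intro b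
      refine BalTensor.hom_ext fun p q => ?_
      obtain ⟨w, hw⟩ := h2 q
      have e : RightTensor.mulFst s t (b * p) =
          RightTensor.mulFst s t b ∘ₗ RightTensor.mulFst s t p :=
        BalTensor.hom_ext fun p q => by simp [RightTensor.mulFst_tmul, mul_assoc]
      have e' : RightTensor.mulFst s t b (BalTensor.tmul _ _ p q) =
          BalTensor.tmul _ _ (b * p) q := RightTensor.mulFst_tmul s t _ _ _
      simp only [LinearMap.comp_apply]
      rw [e', hw, hw, e, LinearMap.comp_apply]
    refine ⟨fun a => ?_, fun b => ?_⟩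
    · obtain ⟨w, hw⟩ := k1 a
      refine ⟨T.unop w, fun b => ?_⟩
      rw [MulOpposite.unop_mul, Module.End.mul_apply, hw]
      exact LinearMap.congr_fun (c1 b) w
    · obtain ⟨w, hw⟩ := k2 b
      refine ⟨T.unop w, fun a => ?_⟩
      rw [MulOpposite.unop_mul, Module.End.mul_apply, hw]
      exact LinearMap.congr_fun (c2 a) w

section RightBase

variable {s t : B →ₗ[ℂ] Multiplier A}

theorem IsRightBase.ext_snd (h : IsRightBase s t) {w w' : RightTensor s t}
    (e : ∀ b, RightTensor.mulSnd s t b w = RightTensor.mulSnd s t b w') : w = w' :=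
  sub_eq_zero.1 (h.nondegenerate_snd _ fun b => by rw [map_sub, e, sub_self])

theorem IsRightBase.ext_fst (h : IsRightBase s t) {w w' : RightTensor s t}
    (e : ∀ b, RightTensor.mulFst s t b w = RightTensor.mulFst s t b w') : w = w' :=
  sub_eq_zero.1 (h.nondegenerate_fst _ fun b => by rw [map_sub, e, sub_self])

/-- The element `(a ⊗ 1)T`. -/
def rightTakeuchi.evalFst (T : rightTakeuchi s t) (a : A) : RightTensor s t := (T.2.1 a).choose

theorem rightTakeuchi.mulSnd_evalFst (T : rightTakeuchi s t) (a b : A) :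
    RightTensor.mulSnd s t b (rightTakeuchi.evalFst T a) = T.1.unop (BalTensor.tmul _ _ a b) :=
  ((T.2.1 a).choose_spec b).symm

/-- The map `(T, a) ↦ (a ⊗ 1)T`. -/
def IsRightBase.evalFst (h : IsRightBase s t) :
    rightTakeuchi s t →ₗ[ℂ] A →ₗ[ℂ] RightTensor s t :=
  LinearMap.mk₂ ℂ rightTakeuchi.evalFst
    (fun T T' a => h.ext_snd fun b => by
      rw [map_add]
      simp only [rightTakeuchi.mulSnd_evalFst]
      rfl)
    (fun r T a => h.ext_snd fun b => by
      rw [map_smul]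
      simp only [rightTakeuchi.mulSnd_evalFst]
      rfl)
    (fun T a a' => h.ext_snd fun b => by
      rw [map_add]
      simp only [rightTakeuchi.mulSnd_evalFst, BalTensor.add_tmul, map_add])
    (fun r T a => h.ext_snd fun b => by
      rw [map_smul]
      simp only [rightTakeuchi.mulSnd_evalFst, BalTensor.smul_tmul, map_smul])

theorem IsRightBase.mulSnd_evalFst (h : IsRightBase s t) (T : rightTakeuchi s t) (a b : A) :
    RightTensor.mulSnd s t b (h.evalFst T a) = T.1.unop (BalTensor.tmul _ _ a b) :=
  rightTakeuchi.mulSnd_evalFst T a b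

/-- The element `(1 ⊗ b)T`. -/
def rightTakeuchi.evalSnd (T : rightTakeuchi s t) (b : A) : RightTensor s t := (T.2.2 b).choose

theorem rightTakeuchi.mulFst_evalSnd (T : rightTakeuchi s t) (a b : A) :
    RightTensor.mulFst s t a (rightTakeuchi.evalSnd T b) = T.1.unop (BalTensor.tmul _ _ a b) :=
  ((T.2.2 b).choose_spec a).symm

/-- The map `(T, b) ↦ (1 ⊗ b)T`. -/
def IsRightBase.evalSnd (h : IsRightBase s t) :
    rightTakeuchi s t →ₗ[ℂ] A →ₗ[ℂ] RightTensor s t :=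
  LinearMap.mk₂ ℂ rightTakeuchi.evalSnd
    (fun T T' b => h.ext_fst fun a => by
      rw [map_add]
      simp only [rightTakeuchi.mulFst_evalSnd]
      rfl)
    (fun r T b => h.ext_fst fun a => by
      rw [map_smul]
      simp only [rightTakeuchi.mulFst_evalSnd]
      rfl)
    (fun T b b' => h.ext_fst fun a => by
      rw [map_add]
      simp only [rightTakeuchi.mulFst_evalSnd, BalTensor.tmul_add, map_add])
    (fun r T b => h.ext_fst fun a => by
      rw [map_smul]
      simp only [rightTakeuchi.mulFst_evalSnd, BalTensor.tmul_smul, map_smul])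

theorem IsRightBase.mulFst_evalSnd (h : IsRightBase s t) (T : rightTakeuchi s t) (a b : A) :
    RightTensor.mulFst s t a (h.evalSnd T b) = T.1.unop (BalTensor.tmul _ _ a b) :=
  rightTakeuchi.mulFst_evalSnd T a b

/-- Right multiplication by `s(y) ⊗ 1` on `^C A ⊗ A_C`, acting from the right. -/
def IsRightBase.actS (h : IsRightBase s t) (y : B) : (Module.End ℂ (RightTensor s t))ᵐᵒᵖ :=
  MulOpposite.op (BalTensor.map (rm (s y)) LinearMap.id
    (fun x a => by rw [← rm_mul, ← h.commute, rm_mul]) (fun _ _ => rfl))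

/-- Right multiplication by `1 ⊗ t(x)` on `^C A ⊗ A_C`, acting from the right. -/
def IsRightBase.actT (h : IsRightBase s t) (x : B) : (Module.End ℂ (RightTensor s t))ᵐᵒᵖ :=
  MulOpposite.op (BalTensor.map LinearMap.id (rm (t x))
    (fun _ _ => rfl) (fun y a => by rw [← rm_mul, h.commute, rm_mul]))

/-- The map `(a, b) ↦ (a ⊗ 1)Δ(b)`. -/
def IsRightBase.preLamT (h : IsRightBase s t) (Δ : A →ₙₐ[ℂ] rightTakeuchi s t) :
    A →ₗ[ℂ] A →ₗ[ℂ] RightTensor s t :=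
  (h.evalFst ∘ₗ (Δ : A →ₗ[ℂ] rightTakeuchi s t)).flip

/-- The map `(a, b) ↦ (1 ⊗ b)Δ(a)`. -/
def IsRightBase.preRhoT (h : IsRightBase s t) (Δ : A →ₙₐ[ℂ] rightTakeuchi s t) :
    A →ₗ[ℂ] A →ₗ[ℂ] RightTensor s t :=
  h.evalSnd ∘ₗ (Δ : A →ₗ[ℂ] rightTakeuchi s t)

end RightBase

/-- `(A, C, s, t, Δ)` is a right multiplier bialgebroid. The four fields `Δ_...` are the bilinearity
condition `Δ(s(y) t(x) a s(y') t(x')) = (s(y) ⊗ t(x)) Δ(a) (s(y') ⊗ t(x'))`, spelled out for one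
factor at a time. -/
structure IsRightMultiplierBialgebroid (s t : B →ₗ[ℂ] Multiplier A)
    (Δ : A →ₙₐ[ℂ] rightTakeuchi s t) : Prop extends IsRightBase s t where
  Δ_s_left : ∀ y a, (Δ (lm (s y) a)).1 = toIsRightBase.actS y * (Δ a).1
  Δ_t_left : ∀ x a, (Δ (lm (t x) a)).1 = toIsRightBase.actT x * (Δ a).1
  Δ_s_right : ∀ y a, (Δ (rm (s y) a)).1 = (Δ a).1 * toIsRightBase.actS y
  Δ_t_right : ∀ x a, (Δ (rm (t x) a)).1 = (Δ a).1 * toIsRightBase.actT x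
  coassoc : Coassociative (toIsRightBase.preLamT Δ) (toIsRightBase.preRhoT Δ)

namespace IsRightMultiplierBialgebroid

variable {s t : B →ₗ[ℂ] Multiplier A} {Δ : A →ₙₐ[ℂ] rightTakeuchi s t}

theorem preLamT_balanced (h : IsRightMultiplierBialgebroid s t Δ) (x : B) (a b : A) :
    h.preLamT Δ (rm (s x) a) b = h.preLamT Δ a (lm (s x) b) := by
  refine h.ext_snd fun c => ?_
  refine (h.mulSnd_evalFst (Δ b) (rm (s x) a) c).trans ?_
  refine Eq.trans ?_ (h.mulSnd_evalFst (Δ (lm (s x) b)) a c).symm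
  rw [h.Δ_s_left]
  simp [IsRightBase.actS]

/-- The canonical map `_λT : A_C ⊗ _C A → ^C A ⊗ A_C`, `a ⊗ b ↦ (a ⊗ 1)Δ(b)`, where
`a s(y) ⊗ b = a ⊗ s(y) b` in the domain. -/
def lamT (h : IsRightMultiplierBialgebroid s t Δ) :
    BalTensor (fun x => rm (s x)) (fun x => lm (s x)) →ₗ[ℂ] RightTensor s t :=
  BalTensor.lift (h.preLamT Δ) h.preLamT_balanced

theorem preRhoT_balanced (h : IsRightMultiplierBialgebroid s t Δ) (x : B) (a b : A) :
    h.preRhoT Δ (lm (t x) a) b = h.preRhoT Δ a (rm (t x) b) := by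
  refine h.ext_fst fun c => ?_
  refine (h.mulFst_evalSnd (Δ (lm (t x) a)) c b).trans ?_
  refine Eq.trans ?_ (h.mulFst_evalSnd (Δ a) c (rm (t x) b)).symm
  rw [h.Δ_t_left]
  simp [IsRightBase.actT]

/-- The canonical map `_ρT : A^C ⊗ ^C A → ^C A ⊗ A_C`, `a ⊗ b ↦ (1 ⊗ b)Δ(a)`, where
`t(y) a ⊗ b = a ⊗ b t(y)` in the domain. -/
def rhoT (h : IsRightMultiplierBialgebroid s t Δ) :
    BalTensor (fun x => lm (t x)) (fun x => rm (t x)) →ₗ[ℂ] RightTensor s t :=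
  BalTensor.lift (h.preRhoT Δ) h.preRhoT_balanced

end IsRightMultiplierBialgebroid

/-- The slice map `φ ⊗ id : ^C A ⊗ A_C → A`, `a ⊗ b ↦ b s(φ(a))`. -/
def IsRightBase.sliceFst {s t : B →ₗ[ℂ] Multiplier A} (h : IsRightBase s t) (φ : A →ₗ[ℂ] B)
    (hφ : ∀ x a, φ (rm (t x) a) = x * φ a) : RightTensor s t →ₗ[ℂ] A :=
  BalTensor.lift
    (LinearMap.mk₂ ℂ (fun a b => rm (s (φ a)) b)
      (fun a a' b => by simp) (fun r a b => by simp)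
      (fun a b b' => by simp) (fun r a b => by simp))
    (fun x a b => by simp [hφ, h.s_mul, rm_mul])

/-- The slice map `id ⊗ ψ : ^C A ⊗ A_C → A`, `a ⊗ b ↦ a t(ψ(b))`. -/
def IsRightBase.sliceSnd {s t : B →ₗ[ℂ] Multiplier A} (h : IsRightBase s t) (ψ : A →ₗ[ℂ] B)
    (hψ : ∀ y a, ψ (rm (s y) a) = ψ a * y) : RightTensor s t →ₗ[ℂ] A :=
  BalTensor.lift
    (LinearMap.mk₂ ℂ (fun a b => rm (t (ψ b)) a)
      (fun a a' b => by simp) (fun r a b => by simp)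
      (fun a b b' => by simp) (fun r a b => by simp))
    (fun x a b => by simp [hψ, h.t_mul, rm_mul])

/-- `ε` is a right counit. -/
structure IsRightCounit {s t : B →ₗ[ℂ] Multiplier A} {Δ : A →ₙₐ[ℂ] rightTakeuchi s t}
    (h : IsRightMultiplierBialgebroid s t Δ) (ε : A →ₗ[ℂ] B) : Prop where
  map_s : ∀ y a, ε (rm (s y) a) = ε a * y
  map_t : ∀ x a, ε (rm (t x) a) = x * ε a
  slice_rhoT : ∀ a b, h.sliceFst ε map_t (h.rhoT (BalTensor.tmul _ _ a b)) = b * a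
  slice_lamT : ∀ a b, h.sliceSnd ε map_s (h.lamT (BalTensor.tmul _ _ a b)) = a * b

end OneSided

/-! ### Multiplier bialgebroids and regular multiplier Hopf algebroids -/

section TwoSided

variable (A : Type*) [NonUnitalRing A] [Module ℂ A] [IsScalarTower ℂ A A] [SMulCommClass ℂ A A]

/-- The inclusion of a subalgebra of `M(A)` as a linear map. -/
def incl {A : Type*} [NonUnitalRing A] [Module ℂ A] [IsScalarTower ℂ A A] [SMulCommClass ℂ A A]
    (B : NonUnitalSubalgebra ℂ (Multiplier A)) : B →ₗ[ℂ] Multiplier A :=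
  B.toSubmodule.subtype

/-- A multiplier bialgebroid `(A, B, C, S_B, S_C, Δ_B, Δ_C)`. The conditions that `A` is
non-degenerate (on both sides) and idempotent are part of `isLeft` and `isRight`. -/
structure MultiplierBialgebroid where
  B : NonUnitalSubalgebra ℂ (Multiplier A)
  C : NonUnitalSubalgebra ℂ (Multiplier A)
  SB : B ≃ₗ[ℂ] C
  SB_mul : ∀ x x', SB (x * x') = SB x' * SB x
  SC : C ≃ₗ[ℂ] B
  SC_mul : ∀ y y', SC (y * y') = SC y' * SC y
  ΔB : A →ₙₐ[ℂ] leftTakeuchi (incl B) (incl C ∘ₗ SB.toLinearMap)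
  ΔC : A →ₙₐ[ℂ] rightTakeuchi (incl C) (incl B ∘ₗ SC.toLinearMap)
  isLeft : IsLeftMultiplierBialgebroid (incl B) (incl C ∘ₗ SB.toLinearMap) ΔB
  isRight : IsRightMultiplierBialgebroid (incl C) (incl B ∘ₗ SC.toLinearMap) ΔC
  /-- `(a ⊗ 1 ⊗ 1)((Δ_C ⊗ id)(Δ_B(b)(1 ⊗ c))) = ((id ⊗ Δ_B)((a ⊗ 1)Δ_C(b)))(1 ⊗ 1 ⊗ c)` -/
  coassoc_CB : Coassociative (isRight.preLamT ΔC) (isLeft.preTrho ΔB)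
  /-- `((Δ_B ⊗ id)((1 ⊗ c)Δ_C(b)))(a ⊗ 1 ⊗ 1) = (1 ⊗ 1 ⊗ c)((id ⊗ Δ_C)(Δ_B(b)(a ⊗ 1)))` -/
  coassoc_BC : Coassociative (isLeft.preTlam ΔB) (isRight.preRhoT ΔC)

namespace MultiplierBialgebroid

variable {A}
variable (𝒜 : MultiplierBialgebroid A)

/-- `_B A ⊗ A^B`, in which `x a ⊗ b = a ⊗ S_B(x) b`. -/
abbrev TensorBB : Type _ := LeftTensor (incl 𝒜.B) (incl 𝒜.C ∘ₗ 𝒜.SB.toLinearMap)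

/-- `^C A ⊗ A_C`, in which `a S_C(y) ⊗ b = a ⊗ b y`. -/
abbrev TensorCC : Type _ := RightTensor (incl 𝒜.C) (incl 𝒜.B ∘ₗ 𝒜.SC.toLinearMap)

/-- For a subalgebra `D` of `M(A)`, the tensor product `_D A ⊗ A_D`, in which
`z a ⊗ b = a ⊗ b z` for `z` in `D`. -/
abbrev TensorOuter (D : NonUnitalSubalgebra ℂ (Multiplier A)) : Type _ :=
  BalTensor (fun z : D => lm (incl D z)) (fun z : D => rm (incl D z))

/-- For a subalgebra `D` of `M(A)`, the tensor product `A_D ⊗ _D A`, in which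
`a z ⊗ b = a ⊗ z b` for `z` in `D`. -/
abbrev TensorInner (D : NonUnitalSubalgebra ℂ (Multiplier A)) : Type _ :=
  BalTensor (fun z : D => rm (incl D z)) (fun z : D => lm (incl D z))

/-- `T_λ : _C A ⊗ A_C → _B A ⊗ A^B`, `a ⊗ b ↦ Δ_B(b)(a ⊗ 1)`. The domain `_C A ⊗ A_C` coincides
with the domain `A^B ⊗ ^B A` of the canonical map of the left multiplier bialgebroid, because
`S_B(B) = C`. -/
def Tlam : TensorOuter 𝒜.C →ₗ[ℂ] 𝒜.TensorBB :=
  BalTensor.lift (𝒜.isLeft.preTlam 𝒜.ΔB) (by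
    intro y a b
    obtain ⟨x, rfl⟩ := 𝒜.SB.surjective y
    exact 𝒜.isLeft.preTlam_balanced x a b)

/-- `T_ρ : A_B ⊗ _B A → _B A ⊗ A^B`, `a ⊗ b ↦ Δ_B(a)(1 ⊗ b)`. -/
def Trho : TensorInner 𝒜.B →ₗ[ℂ] 𝒜.TensorBB := 𝒜.isLeft.Trho

/-- `_λT : A_C ⊗ _C A → ^C A ⊗ A_C`, `a ⊗ b ↦ (a ⊗ 1)Δ_C(b)`. -/
def lamT : TensorInner 𝒜.C →ₗ[ℂ] 𝒜.TensorCC := 𝒜.isRight.lamT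

/-- `_ρT : _B A ⊗ A_B → ^C A ⊗ A_C`, `a ⊗ b ↦ (1 ⊗ b)Δ_C(a)`. The domain `_B A ⊗ A_B` coincides
with the domain `A^C ⊗ ^C A` of the canonical map of the right multiplier bialgebroid, because
`S_C(C) = B`. -/
def rhoT : TensorOuter 𝒜.B →ₗ[ℂ] 𝒜.TensorCC :=
  BalTensor.lift (𝒜.isRight.preRhoT 𝒜.ΔC) (by
    intro x a b
    obtain ⟨y, rfl⟩ := 𝒜.SC.surjective x
    exact 𝒜.isRight.preRhoT_balanced y a b)

/-- `_B I`, the span of all `ω(a)` with `ω ∈ Hom(_B A, _B B)`. -/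
def idealBs : Submodule ℂ 𝒜.B :=
  Submodule.span ℂ {z | ∃ (ω : A →ₗ[ℂ] 𝒜.B) (a : A),
    (∀ (x : 𝒜.B) (b : A), ω (lm x.1 b) = x * ω b) ∧ z = ω a}

/-- `I^B`, the span of all `ω(a)` with `ω ∈ Hom(A^B, B_B)`. -/
def idealBt : Submodule ℂ 𝒜.B :=
  Submodule.span ℂ {z | ∃ (ω : A →ₗ[ℂ] 𝒜.B) (a : A),
    (∀ (x : 𝒜.B) (b : A), ω (lm (𝒜.SB x).1 b) = ω b * x) ∧ z = ω a}

/-- `I_C`, the span of all `ω(a)` with `ω ∈ Hom(A_C, C_C)`. -/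
def idealCs : Submodule ℂ 𝒜.C :=
  Submodule.span ℂ {z | ∃ (ω : A →ₗ[ℂ] 𝒜.C) (a : A),
    (∀ (y : 𝒜.C) (b : A), ω (rm y.1 b) = ω b * y) ∧ z = ω a}

/-- `^C I`, the span of all `ω(a)` with `ω ∈ Hom(^C A, _C C)`. -/
def idealCt : Submodule ℂ 𝒜.C :=
  Submodule.span ℂ {z | ∃ (ω : A →ₗ[ℂ] 𝒜.C) (a : A),
    (∀ (y : 𝒜.C) (b : A), ω (rm (𝒜.SC y).1 b) = y * ω b) ∧ z = ω a}

/-- `𝒜` is a regular multiplier Hopf algebroid. -/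
structure IsRegularMultiplierHopfAlgebroid : Prop where
  full_Bs : Submodule.span ℂ {z : A | ∃ x ∈ 𝒜.idealBs, ∃ a, z = lm (𝒜.SB x).1 a} = ⊤
  full_Bt : Submodule.span ℂ {z : A | ∃ x ∈ 𝒜.idealBt, ∃ a, z = lm x.1 a} = ⊤
  full_Cs : Submodule.span ℂ {z : A | ∃ y ∈ 𝒜.idealCs, ∃ a, z = rm (𝒜.SC y).1 a} = ⊤
  full_Ct : Submodule.span ℂ {z : A | ∃ y ∈ 𝒜.idealCt, ∃ a, z = rm y.1 a} = ⊤
  bijective_Tlam : Function.Bijective 𝒜.Tlam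
  bijective_Trho : Function.Bijective 𝒜.Trho
  bijective_lamT : Function.Bijective 𝒜.lamT
  bijective_rhoT : Function.Bijective 𝒜.rhoT

/-- `S` is an anti-automorphism of `A` with
`S(x y a x' y') = S_C(y') S_B(x') S(a) S_C(y) S_B(x)` for all `x`, `x'` in `B` and `y`, `y'` in `C`. -/
structure IsBimoduleAntiAut (S : A ≃ₗ[ℂ] A) : Prop where
  map_mul : ∀ a b, S (a * b) = S b * S a
  bimodule : ∀ (x x' : 𝒜.B) (y y' : 𝒜.C) (a : A),
    S (rm y'.1 (rm x'.1 (lm x.1 (lm y.1 a)))) =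
      lm (𝒜.SC y').1 (lm (𝒜.SB x').1 (rm (𝒜.SB x).1 (rm (𝒜.SC y).1 (S a))))

theorem hom_ext_of_idempotent {κ : Type*} {M : Type*} [AddCommGroup M] [Module ℂ M]
    (φ : κ → Module.End ℂ A) (hφ : Submodule.span ℂ {z : A | ∃ x a, z = φ x a} = ⊤)
    {F G : A →ₗ[ℂ] M} (h : ∀ x, F ∘ₗ φ x = G ∘ₗ φ x) : F = G := by
  refine LinearMap.ext_on hφ ?_
  rintro _ ⟨x, a, rfl⟩
  exact LinearMap.congr_fun (h x) a

theorem hom_ext₄ {M : Type*} [AddCommGroup M] [Module ℂ M] {F G : A →ₗ[ℂ] M}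
    (h : ∀ (x x' : 𝒜.B) (y y' : 𝒜.C) (a : A),
      F (rm y'.1 (rm x'.1 (lm x.1 (lm y.1 a)))) = G (rm y'.1 (rm x'.1 (lm x.1 (lm y.1 a))))) :
    F = G := by
  refine hom_ext_of_idempotent _ 𝒜.isRight.s_idempotent fun y' => ?_
  refine hom_ext_of_idempotent _ 𝒜.isRight.t_idempotent fun y₁ => ?_
  refine hom_ext_of_idempotent _ 𝒜.isLeft.s_idempotent fun x => ?_
  refine hom_ext_of_idempotent _ 𝒜.isLeft.t_idempotent fun x₁ => ?_
  exact LinearMap.ext fun a => h x (𝒜.SC y₁) (𝒜.SB x₁) y' a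

theorem lm_rm_comm (𝒜 : MultiplierBialgebroid A) (T T' : Multiplier A) (a : A) : lm T (rm T' a) = rm T' (lm T a) := by
  refine sub_eq_zero.1 (𝒜.isRight.nondegenerate _ fun c => ?_)
  rw [mul_sub, mul_lm, ← rm_mul_left, ← rm_mul_left, mul_lm, sub_self]

theorem mul_comm_BC (x : 𝒜.B) (y : 𝒜.C) : x.1 * y.1 = y.1 * x.1 := by
  obtain ⟨x', rfl⟩ := 𝒜.SB.surjective y
  exact 𝒜.isLeft.commute x x'

theorem lm_comm_BC (x : 𝒜.B) (y : 𝒜.C) (a : A) : lm x.1 (lm y.1 a) = lm y.1 (lm x.1 a) := by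
  rw [← lm_mul, 𝒜.mul_comm_BC, lm_mul]

theorem rm_comm_BC (x : 𝒜.B) (y : 𝒜.C) (a : A) : rm x.1 (rm y.1 a) = rm y.1 (rm x.1 a) := by
  rw [← rm_mul, ← 𝒜.mul_comm_BC, rm_mul]

namespace IsBimoduleAntiAut

variable {𝒜} {S : A ≃ₗ[ℂ] A}

theorem map_lm_B (h : 𝒜.IsBimoduleAntiAut S) (x : 𝒜.B) (a : A) :
    S (lm x.1 a) = rm (𝒜.SB x).1 (S a) := by
  suffices e : S.toLinearMap ∘ₗ lm x.1 = rm (𝒜.SB x).1 ∘ₗ S.toLinearMap from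
    LinearMap.congr_fun e a
  refine 𝒜.hom_ext₄ fun x₁ x' y y' a => ?_
  have e1 := h.bimodule (x * x₁) x' y y' a
  have e2 := h.bimodule x₁ x' y y' a
  simp only [𝒜.SB_mul, NonUnitalSubalgebra.coe_mul, lm_mul, rm_mul] at e1
  simp only [LinearMap.comp_apply, LinearEquiv.coe_coe, 𝒜.lm_rm_comm, e1, e2]

theorem map_lm_C (h : 𝒜.IsBimoduleAntiAut S) (y : 𝒜.C) (a : A) :
    S (lm y.1 a) = rm (𝒜.SC y).1 (S a) := by
  suffices e : S.toLinearMap ∘ₗ lm y.1 = rm (𝒜.SC y).1 ∘ₗ S.toLinearMap from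
    LinearMap.congr_fun e a
  refine 𝒜.hom_ext₄ fun x x' y₁ y' a => ?_
  have e1 := h.bimodule x x' (y * y₁) y' a
  have e2 := h.bimodule x x' y₁ y' a
  simp only [𝒜.SC_mul, NonUnitalSubalgebra.coe_mul, lm_mul, rm_mul] at e1
  rw [𝒜.lm_comm_BC, ← 𝒜.rm_comm_BC (𝒜.SC y) (𝒜.SB x)] at e1
  simp only [LinearMap.comp_apply, LinearEquiv.coe_coe, 𝒜.lm_rm_comm, e1, e2]

theorem map_rm_B (h : 𝒜.IsBimoduleAntiAut S) (x : 𝒜.B) (a : A) :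
    S (rm x.1 a) = lm (𝒜.SB x).1 (S a) := by
  suffices e : S.toLinearMap ∘ₗ rm x.1 = lm (𝒜.SB x).1 ∘ₗ S.toLinearMap from
    LinearMap.congr_fun e a
  refine 𝒜.hom_ext₄ fun x₁ x' y y' a => ?_
  have e1 := h.bimodule x₁ (x' * x) y y' a
  have e2 := h.bimodule x₁ x' y y' a
  simp only [𝒜.SB_mul, NonUnitalSubalgebra.coe_mul, lm_mul, rm_mul] at e1
  rw [← 𝒜.rm_comm_BC x y', 𝒜.lm_comm_BC (𝒜.SC y') (𝒜.SB x)] at e1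
  simp only [LinearMap.comp_apply, LinearEquiv.coe_coe, e1, e2]

theorem map_rm_C (h : 𝒜.IsBimoduleAntiAut S) (y : 𝒜.C) (a : A) :
    S (rm y.1 a) = lm (𝒜.SC y).1 (S a) := by
  suffices e : S.toLinearMap ∘ₗ rm y.1 = lm (𝒜.SC y).1 ∘ₗ S.toLinearMap from
    LinearMap.congr_fun e a
  refine 𝒜.hom_ext₄ fun x x' y₁ y' a => ?_
  have e1 := h.bimodule x x' y₁ (y' * y) a
  have e2 := h.bimodule x x' y₁ y' a
  simp only [𝒜.SC_mul, NonUnitalSubalgebra.coe_mul, lm_mul, rm_mul] at e1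
  simp only [LinearMap.comp_apply, LinearEquiv.coe_coe, e1, e2]

/-- The composition `m_C ∘ (S ⊗ id) : _B A ⊗ A^B → A_C ⊗ _C A → A`, `a ⊗ b ↦ S(a) b`. -/
def mulFst (h : 𝒜.IsBimoduleAntiAut S) : 𝒜.TensorBB →ₗ[ℂ] A :=
  BalTensor.lift ((LinearMap.mul ℂ A) ∘ₗ S.toLinearMap) (fun x a b => by
    refine (congrArg (· * b) (h.map_lm_B x a)).trans ?_
    exact (mul_lm _ _ _).symm)

/-- The composition `m_B ∘ (id ⊗ S) : ^C A ⊗ A_C → A_B ⊗ _B A → A`, `a ⊗ b ↦ a S(b)`. -/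
def mulSnd (h : 𝒜.IsBimoduleAntiAut S) : 𝒜.TensorCC →ₗ[ℂ] A :=
  BalTensor.lift ((LinearMap.mul ℂ A).compl₂ S.toLinearMap) (fun y a b => by
    refine Eq.trans ?_ (congrArg (a * ·) (h.map_rm_C y b)).symm
    exact (mul_lm _ _ _).symm)

end IsBimoduleAntiAut

/-- `S` is an invertible antipode for `𝒜`. -/
structure IsInvertibleAntipode (S : A ≃ₗ[ℂ] A) : Prop extends 𝒜.IsBimoduleAntiAut S where
  counits : ∃ (εB : A →ₗ[ℂ] 𝒜.B) (εC : A →ₗ[ℂ] 𝒜.C),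
    IsLeftCounit 𝒜.isLeft εB ∧ IsRightCounit 𝒜.isRight εC ∧
    (∀ a b, toIsBimoduleAntiAut.mulFst (𝒜.Trho (BalTensor.tmul _ _ a b)) =
      lm (𝒜.SC (εC a)).1 b) ∧
    (∀ a b, toIsBimoduleAntiAut.mulSnd (𝒜.lamT (BalTensor.tmul _ _ a b)) =
      rm (𝒜.SB (εB b)).1 a)

/-- The bilinear map `(a, b) ↦ S(b) ⊗ S(a)` to a balanced tensor product. -/
def flipMk {ι : Type*} (S : A ≃ₗ[ℂ] A) (f g : ι → Module.End ℂ A) :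
    A →ₗ[ℂ] A →ₗ[ℂ] BalTensor f g :=
  (BalTensor.mk₂ f g).flip.compl₁₂ S.toLinearMap S.toLinearMap

theorem flipMk_apply {ι : Type*} (S : A ≃ₗ[ℂ] A) (f g : ι → Module.End ℂ A) (a b : A) :
    flipMk S f g a b = BalTensor.tmul f g (S b) (S a) := rfl

namespace IsInvertibleAntipode

variable {𝒜} {S : A ≃ₗ[ℂ] A}

/-- `Σ(S ⊗ S) : _C A ⊗ A_C → _B A ⊗ A_B`, `a ⊗ b ↦ S(b) ⊗ S(a)`. -/
def flipOuter (h : 𝒜.IsInvertibleAntipode S) : TensorOuter 𝒜.C →ₗ[ℂ] TensorOuter 𝒜.B :=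
  BalTensor.lift (flipMk S _ _) (fun y a b => by
    refine (congrArg (BalTensor.tmul _ _ (S b)) (h.map_lm_C y a)).trans ?_
    refine Eq.trans ?_ (congrArg (BalTensor.tmul _ _ · (S a)) (h.map_rm_C y b)).symm
    exact (BalTensor.tmul_balanced _ _ (𝒜.SC y) (S b) (S a)).symm)

/-- `Σ(S ⊗ S) : A_C ⊗ _C A → A_B ⊗ _B A`, `a ⊗ b ↦ S(b) ⊗ S(a)`. -/
def flipInner (h : 𝒜.IsInvertibleAntipode S) : TensorInner 𝒜.C →ₗ[ℂ] TensorInner 𝒜.B :=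
  BalTensor.lift (flipMk S _ _) (fun y a b => by
    refine (congrArg (BalTensor.tmul _ _ (S b)) (h.map_rm_C y a)).trans ?_
    refine Eq.trans ?_ (congrArg (BalTensor.tmul _ _ · (S a)) (h.map_lm_C y b)).symm
    exact (BalTensor.tmul_balanced _ _ (𝒜.SC y) (S b) (S a)).symm)

/-- `Σ(S ⊗ S) : _B A ⊗ A^B → ^C A ⊗ A_C`, `a ⊗ b ↦ S(b) ⊗ S(a)`. -/
def flipBC (h : 𝒜.IsInvertibleAntipode S) : 𝒜.TensorBB →ₗ[ℂ] 𝒜.TensorCC :=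
  BalTensor.lift (flipMk S _ _) (fun x a b => by
    refine (congrArg (BalTensor.tmul _ _ (S b)) (h.map_lm_B x a)).trans ?_
    refine Eq.trans ?_ (congrArg (BalTensor.tmul _ _ · (S a)) (h.map_lm_C (𝒜.SB x) b)).symm
    exact (BalTensor.tmul_balanced _ _ (𝒜.SB x) (S b) (S a)).symm)

/-- `Σ(S ⊗ S) : ^C A ⊗ A_C → _B A ⊗ A^B`, `a ⊗ b ↦ S(b) ⊗ S(a)`. -/
def flipCB (h : 𝒜.IsInvertibleAntipode S) : 𝒜.TensorCC →ₗ[ℂ] 𝒜.TensorBB :=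
  BalTensor.lift (flipMk S _ _) (fun y a b => by
    refine (congrArg (BalTensor.tmul _ _ (S b)) (h.map_rm_B (𝒜.SC y) a)).trans ?_
    refine Eq.trans ?_ (congrArg (BalTensor.tmul _ _ · (S a)) (h.map_rm_C y b)).symm
    exact (BalTensor.tmul_balanced _ _ (𝒜.SC y) (S b) (S a)).symm)

end IsInvertibleAntipode

end MultiplierBialgebroid

end TwoSided

end MultHopf

end

open scoped TensorProduct

noncomputable section

namespace MultHopf

/-! ### Maps out of balanced tensor products, and coassociativity tested against them. -/

section Lift

variable {A : Type*} [NonUnitalRing A] [Module ℂ A]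
variable {ι κ : Type*} {M : Type*} [AddCommGroup M] [Module ℂ M]

/-! Two inversion formulas drive the proof: `T_ρ (id ⊗ S) _ρT = id ⊗ S` (`Trho_idTensor_rhoT`) and
`_λT (S ⊗ id) T_λ = S ⊗ id` (`lamT_tensorId_Tlam`). Both come from the mixed coassociativity of
`Δ_B` and `Δ_C`: two neighbouring legs are contracted with the antipode, which produces a counit,
and the counit is absorbed by its slice identity.

The second assertion is proved first. It says `Δ_B(S(b))(1 ⊗ S(a)) = Σ(S ⊗ S)((a ⊗ 1)Δ_C(b))`. The
two sides are compared after acting by `Δ_B(c)` for all `c`. This loses nothing (`ext_ΔB`): the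
bijection `T_ρ` turns left multiplication by `c ⊗ 1` into the action of `Δ_B(c)`, and the former is
non-degenerate on `A_B ⊗ _B A`, because `id ⊗ S` identifies that space with `^C A ⊗ A_C`. What
remains is `Δ_B(c S(b))(1 ⊗ S(a)) = Δ_B(c) Σ(S ⊗ S)((a ⊗ 1)Δ_C(b))`.

Since `_λT` is surjective, `c ⊗ b` may be replaced by `(p ⊗ 1)Δ_C(q)`, formally `p q₁ ⊗ q₂`. By
coassociativity of `Δ_C` the right side becomes `Δ_B(p q₁)(S(q₃) ⊗ S(a q₂))`. The first inversion
formula gives `Δ_B(q₁)(1 ⊗ S(a q₂)) = q₁ ⊗ S(a)`, with `q₂` standing for the remaining leg. Hence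
the expression collapses to `Δ_B(p)(q₁ S(q₂) ⊗ S(a))`. The antipode axiom and bilinearity of `Δ_B`
identify this with the left side. This is `actFlip_eq_of_proj_eq_lamT`; such formal expressions make
sense only after multiplying by further elements, which is why auxiliary factors appear throughout.

The first assertion is then formal: apply the injective map `T_ρ (id ⊗ S)` to both sides, and use
the second assertion together with both inversion formulas. -/

theorem BalTensor.induction_on {f g : ι → Module.End ℂ A} {p : BalTensor f g → Prop}
    (z : BalTensor f g) (tmul : ∀ a b, p (BalTensor.tmul f g a b))
    (add : ∀ w w', p w → p w' → p (w + w')) : p z := by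
  obtain ⟨u, rfl⟩ : ∃ u, BalTensor.proj f g u = z := Submodule.mkQ_surjective _ z
  induction u with
  | zero =>
    -- The zero class is the elementary tensor `0 ⊗ 0`, so the principle needs no separate
    -- hypothesis for zero.
    have h := tmul 0 0
    rwa [BalTensor.tmul, TensorProduct.zero_tmul] at h
  | tmul a b => exact tmul a b
  | add u u' hu hu' =>
    rw [map_add]
    exact add _ _ hu hu'

/-- The linear map out of a threefold balanced tensor product induced by a balanced trilinear
map. -/
def BalTensor₃.lift {f g : ι → Module.End ℂ A} {f₂ g₂ : κ → Module.End ℂ A}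
    (F : A →ₗ[ℂ] A →ₗ[ℂ] A →ₗ[ℂ] M) (h₁ : ∀ x a b c, F (f x a) b c = F a (g x b) c)
    (h₂ : ∀ y a b c, F a (f₂ y b) c = F a b (g₂ y c)) : BalTensor₃ f g f₂ g₂ →ₗ[ℂ] M :=
  (balancedRel₃ f g f₂ g₂).liftQ
    (TensorProduct.lift ((TensorProduct.uncurry (.id ℂ) A A M) ∘ₗ F)) (by
    refine Submodule.span_le.2 ?_
    rintro _ (⟨x, a, b, c, rfl⟩ | ⟨y, a, b, c, rfl⟩)
    · simp [h₁]
    · simp [h₂])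

theorem BalTensor₃.lift_mk₃ {f g : ι → Module.End ℂ A} {f₂ g₂ : κ → Module.End ℂ A}
    (F : A →ₗ[ℂ] A →ₗ[ℂ] A →ₗ[ℂ] M) (h₁ : ∀ x a b c, F (f x a) b c = F a (g x b) c)
    (h₂ : ∀ y a b c, F a (f₂ y b) c = F a b (g₂ y c)) (a b c : A) :
    BalTensor₃.lift F h₁ h₂ (BalTensor₃.mk₃ f g f₂ g₂ a b c) = F a b c :=
  TensorProduct.lift.tmul _ _

/-- Coassociativity, evaluated under a balanced trilinear map `F`. The maps `P` and `Q` describe `F`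
on the first two and on the last two factors. -/
theorem Coassociative.lift_eq {f g : ι → Module.End ℂ A} {f₂ g₂ : κ → Module.End ℂ A}
    {U : A →ₗ[ℂ] A →ₗ[ℂ] BalTensor f g} {V : A →ₗ[ℂ] A →ₗ[ℂ] BalTensor f₂ g₂}
    (h : Coassociative U V) (F : A →ₗ[ℂ] A →ₗ[ℂ] A →ₗ[ℂ] M)
    (h₁ : ∀ x a b c, F (f x a) b c = F a (g x b) c)
    (h₂ : ∀ y a b c, F a (f₂ y b) c = F a b (g₂ y c))
    (P : A → BalTensor f g →ₗ[ℂ] M) (hP : ∀ a b c, P c (BalTensor.tmul f g a b) = F a b c)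
    (Q : A → BalTensor f₂ g₂ →ₗ[ℂ] M) (hQ : ∀ a b c, Q a (BalTensor.tmul f₂ g₂ b c) = F a b c)
    (a b c : A) (u v : A ⊗[ℂ] A) (hu : BalTensor.proj f g u = U a b)
    (hv : BalTensor.proj f₂ g₂ v = V b c) (X Y : A ⊗[ℂ] A →ₗ[ℂ] M)
    (hX : ∀ p q, X (p ⊗ₜ q) = P q (U a p)) (hY : ∀ p q, Y (p ⊗ₜ q) = Q p (V q c)) :
    X v = Y u := by
  have eP : ∀ c w, BalTensor₃.lift F h₁ h₂ (BalTensor₃.appendRight f g f₂ g₂ w c) = P c w := by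
    intro c w
    induction w using BalTensor.induction_on with
    | tmul a b => rw [BalTensor₃.appendRight_tmul, BalTensor₃.lift_mk₃, hP]
    | add w w' e e' => rw [map_add, LinearMap.add_apply, map_add, e, e', map_add]
  have eQ : ∀ a w, BalTensor₃.lift F h₁ h₂ (BalTensor₃.appendLeft f g f₂ g₂ a w) = Q a w := by
    intro a w
    induction w using BalTensor.induction_on with
    | tmul b c => rw [BalTensor₃.appendLeft_tmul, BalTensor₃.lift_mk₃, hQ]
    | add w w' e e' => rw [map_add, map_add, e, e', map_add]
  -- The values on elementary tensors determine `X` and `Y`. They are nevertheless passed as data,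
  -- so that each application can supply a form in which `u` or `v` enters only through its class.
  have eX : X = BalTensor₃.lift F h₁ h₂ ∘ₗ
      TensorProduct.lift ((BalTensor₃.appendRight f g f₂ g₂) ∘ₗ U a) :=
    TensorProduct.ext' fun p q => by simp [hX, eP]
  have eY : Y = BalTensor₃.lift F h₁ h₂ ∘ₗ
      TensorProduct.lift ((BalTensor₃.appendLeft f g f₂ g₂).compl₂ (V.flip c)) :=
    TensorProduct.ext' fun p q => by simp [hY, eQ]
  rw [eX, eY, LinearMap.comp_apply, LinearMap.comp_apply, h a b c u v hu hv]

/-- The trilinear map `(a, b, c) ↦ a ⊗ b G(c)` to a balanced tensor product. -/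
def BalTensor.tmulMul [IsScalarTower ℂ A A] [SMulCommClass ℂ A A] (f g : ι → Module.End ℂ A)
    (G : Module.End ℂ A) : A →ₗ[ℂ] A →ₗ[ℂ] A →ₗ[ℂ] BalTensor f g :=
  LinearMap.mk₂ ℂ (fun a b => BalTensor.mk₂ f g a ∘ₗ LinearMap.mul ℂ A b ∘ₗ G)
    (fun _ _ _ => by ext; simp)
    (fun _ _ _ => by ext; simp)
    (fun _ _ _ => by ext; simp [BalTensor.tmul_add])
    (fun _ _ _ => by ext; simp)

@[simp]
theorem BalTensor.tmulMul_apply [IsScalarTower ℂ A A] [SMulCommClass ℂ A A]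
    (f g : ι → Module.End ℂ A) (G : Module.End ℂ A) (a b c : A) :
    BalTensor.tmulMul f g G a b c = BalTensor.tmul f g a (b * G c) := rfl

/-- The trilinear map `(a, b, c) ↦ F(a) b ⊗ c` to a balanced tensor product. -/
def BalTensor.mulTmul [IsScalarTower ℂ A A] [SMulCommClass ℂ A A] (f g : ι → Module.End ℂ A)
    (F : Module.End ℂ A) : A →ₗ[ℂ] A →ₗ[ℂ] A →ₗ[ℂ] BalTensor f g :=
  LinearMap.mk₂ ℂ (fun a b => BalTensor.mk₂ f g (F a * b))
    (fun _ _ _ => by ext; simp [add_mul])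
    (fun _ _ _ => by ext; simp [smul_mul_assoc])
    (fun _ _ _ => by ext; simp [mul_add])
    (fun _ _ _ => by ext; simp [mul_smul_comm])

@[simp]
theorem BalTensor.mulTmul_apply [IsScalarTower ℂ A A] [SMulCommClass ℂ A A]
    (f g : ι → Module.End ℂ A) (F : Module.End ℂ A) (a b c : A) :
    BalTensor.mulTmul f g F a b c = BalTensor.tmul f g (F a * b) c := rfl

/-- The trilinear map `(a, b, c) ↦ D(a)(β(b, c))`. -/
def compTrilinear {N : Type*} [AddCommGroup N] [Module ℂ N] (D : A →ₗ[ℂ] Module.End ℂ N)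
    (β : A →ₗ[ℂ] A →ₗ[ℂ] N) : A →ₗ[ℂ] A →ₗ[ℂ] A →ₗ[ℂ] N :=
  LinearMap.mk₂ ℂ (fun a b => D a ∘ₗ β b)
    (fun _ _ _ => by ext; simp) (fun _ _ _ => by ext; simp)
    (fun _ _ _ => by ext; simp) (fun _ _ _ => by ext; simp)

theorem BalTensor.exists_proj {f g : ι → Module.End ℂ A} (w : BalTensor f g) :
    ∃ u, BalTensor.proj f g u = w :=
  Submodule.mkQ_surjective _ w

end Lift

/-! ### The actions of `A` defined by one-sided comultiplications. -/

section OneSided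

variable {A : Type*} [NonUnitalRing A] [Module ℂ A] [IsScalarTower ℂ A A] [SMulCommClass ℂ A A]
variable {B : Type*} [NonUnitalRing B] [Module ℂ B]
variable {s t : B →ₗ[ℂ] Multiplier A}

/-- The action of `A` on `_B A ⊗ A^B` by left multiplication via `Δ`. -/
def leftComulAction (Δ : A →ₙₐ[ℂ] leftTakeuchi s t) : A →ₗ[ℂ] Module.End ℂ (LeftTensor s t) :=
  (leftTakeuchi s t).toSubmodule.subtype ∘ₗ (Δ : A →ₗ[ℂ] leftTakeuchi s t)

theorem LeftTensor.mulFst_mul (a b : A) (w : LeftTensor s t) :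
    LeftTensor.mulFst s t (a * b) w = LeftTensor.mulFst s t b (LeftTensor.mulFst s t a w) := by
  induction w using BalTensor.induction_on with
  | tmul p q => simp only [LeftTensor.mulFst_tmul, mul_assoc]
  | add w w' e e' => simp only [map_add, e, e']

/-- Existence of the element `Δ(c)(1 ⊗ q)` forces this: both sides on `p ⊗ q` equal `(Δ(c)(1 ⊗
q))(pd ⊗ 1)`. -/
theorem IsLeftBase.leftComulAction_mulFst (h : IsLeftBase s t) (Δ : A →ₙₐ[ℂ] leftTakeuchi s t)
    (c d : A) (w : LeftTensor s t) :
    leftComulAction Δ c (LeftTensor.mulFst s t d w) =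
      LeftTensor.mulFst s t d (leftComulAction Δ c w) := by
  induction w using BalTensor.induction_on with
  | tmul p q =>
    rw [LeftTensor.mulFst_tmul]
    refine (h.mulFst_evalSnd (Δ c) (p * d) q).symm.trans ?_
    rw [LeftTensor.mulFst_mul, h.mulFst_evalSnd]
    rfl
  | add w w' e e' => simp only [map_add, e, e']

namespace IsLeftMultiplierBialgebroid

variable {Δ : A →ₙₐ[ℂ] leftTakeuchi s t}

theorem mulFst_preTrho (h : IsLeftMultiplierBialgebroid s t Δ) (a b c : A) :
    LeftTensor.mulFst s t c (h.preTrho Δ a b) = leftComulAction Δ a (BalTensor.tmul _ _ c b) :=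
  h.mulFst_evalSnd (Δ a) c b

theorem mulSnd_preTlam (h : IsLeftMultiplierBialgebroid s t Δ) (a b c : A) :
    LeftTensor.mulSnd s t c (h.preTlam Δ a b) = leftComulAction Δ b (BalTensor.tmul _ _ a c) :=
  h.mulSnd_evalFst (Δ b) a c

/-- Multiplicativity of `Δ` concerns operators, whereas `Δ(a)(1 ⊗ b)` is an element. Right
multiplication by `d ⊗ 1` reduces the claim to `Δ(ca)(d ⊗ b) = Δ(c)Δ(a)(d ⊗ b)`. -/
theorem preTrho_mul (h : IsLeftMultiplierBialgebroid s t Δ) (a b c : A) :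
    h.preTrho Δ (c * a) b = leftComulAction Δ c (h.preTrho Δ a b) :=
  h.ext_fst fun d => by
    rw [h.mulFst_preTrho, ← h.leftComulAction_mulFst, h.mulFst_preTrho]
    exact congrArg (fun T : leftTakeuchi s t => T.1 (BalTensor.tmul _ _ d b)) (map_mul Δ c a)

end IsLeftMultiplierBialgebroid

namespace IsRightMultiplierBialgebroid

variable {Δ : A →ₙₐ[ℂ] rightTakeuchi s t}

/-- Both sides are `(c ⊗ b)Δ(a)`. This is the exchange law between `_ρT` and `_λT`. -/
theorem mulFst_preRhoT (h : IsRightMultiplierBialgebroid s t Δ) (a b c : A) :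
    RightTensor.mulFst s t c (h.preRhoT Δ a b) = RightTensor.mulSnd s t b (h.preLamT Δ c a) :=
  (h.mulFst_evalSnd (Δ a) c b).trans (h.mulSnd_evalFst (Δ a) c b).symm

end IsRightMultiplierBialgebroid

end OneSided

namespace MultiplierBialgebroid

variable {A : Type*} [NonUnitalRing A] [Module ℂ A] [IsScalarTower ℂ A A] [SMulCommClass ℂ A A]
variable {𝒜 : MultiplierBialgebroid A} {S : A ≃ₗ[ℂ] A}

/-! ### Applying the antipode to a single leg. -/

namespace IsBimoduleAntiAut

/-- `id ⊗ S : ^C A ⊗ A_C → A_B ⊗ _B A`. -/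
def idTensor (h : 𝒜.IsBimoduleAntiAut S) : 𝒜.TensorCC →ₗ[ℂ] TensorInner 𝒜.B :=
  BalTensor.lift ((BalTensor.mk₂ _ _).compl₂ S.toLinearMap) (fun y a b => by
    refine Eq.trans ?_ (congrArg (BalTensor.tmul _ _ a) (h.map_rm_C y b)).symm
    exact BalTensor.tmul_balanced _ _ (𝒜.SC y) a (S b))

theorem idTensor_tmul (h : 𝒜.IsBimoduleAntiAut S) (a b : A) :
    h.idTensor (BalTensor.tmul _ _ a b) = BalTensor.tmul _ _ a (S b) :=
  BalTensor.lift_tmul _ _ _ _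

/-- `id ⊗ S⁻¹ : A_B ⊗ _B A → ^C A ⊗ A_C`. -/
def idTensorInv (h : 𝒜.IsBimoduleAntiAut S) : TensorInner 𝒜.B →ₗ[ℂ] 𝒜.TensorCC :=
  BalTensor.lift ((BalTensor.mk₂ _ _).compl₂ S.symm.toLinearMap) (fun x a b => by
    -- The relations of the source are indexed by `B`, those of the target by `C`; bijectivity of
    -- `S_C` matches them.
    obtain ⟨y, rfl⟩ := 𝒜.SC.surjective x
    have e : S.symm (lm (𝒜.SC y).1 b) = rm y.1 (S.symm b) := by
      rw [LinearEquiv.symm_apply_eq, h.map_rm_C, LinearEquiv.apply_symm_apply]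
    refine Eq.trans ?_ (congrArg (BalTensor.tmul _ _ a) e).symm
    exact BalTensor.tmul_balanced _ _ y a (S.symm b))

theorem idTensorInv_tmul (h : 𝒜.IsBimoduleAntiAut S) (a b : A) :
    h.idTensorInv (BalTensor.tmul _ _ a b) = BalTensor.tmul _ _ a (S.symm b) :=
  BalTensor.lift_tmul _ _ _ _

/-- Together with its converse, this carries the non-degeneracy of `^C A ⊗ A_C` over to `A_B ⊗ _B
A`, and allows `id ⊗ S` to be cancelled. -/
theorem idTensorInv_idTensor (h : 𝒜.IsBimoduleAntiAut S) (w : 𝒜.TensorCC) :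
    h.idTensorInv (h.idTensor w) = w := by
  induction w using BalTensor.induction_on with
  | tmul a b => rw [idTensor_tmul, idTensorInv_tmul, LinearEquiv.symm_apply_apply]
  | add w w' e e' => simp only [map_add, e, e']

theorem idTensor_idTensorInv (h : 𝒜.IsBimoduleAntiAut S) (w : TensorInner 𝒜.B) :
    h.idTensor (h.idTensorInv w) = w := by
  induction w using BalTensor.induction_on with
  | tmul a b => rw [idTensorInv_tmul, idTensor_tmul, LinearEquiv.apply_symm_apply]
  | add w w' e e' => simp only [map_add, e, e']

/-- `S ⊗ id : _B A ⊗ A^B → A_C ⊗ _C A`. -/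
def tensorId (h : 𝒜.IsBimoduleAntiAut S) : 𝒜.TensorBB →ₗ[ℂ] TensorInner 𝒜.C :=
  BalTensor.lift ((BalTensor.mk₂ _ _) ∘ₗ S.toLinearMap) (fun x a b => by
    refine (congrArg (BalTensor.tmul _ _ · b) (h.map_lm_B x a)).trans ?_
    exact BalTensor.tmul_balanced _ _ (𝒜.SB x) (S a) b)

theorem tensorId_tmul (h : 𝒜.IsBimoduleAntiAut S) (a b : A) :
    h.tensorId (BalTensor.tmul _ _ a b) = BalTensor.tmul _ _ (S a) b :=
  BalTensor.lift_tmul _ _ _ _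

theorem mulFst_tmul (h : 𝒜.IsBimoduleAntiAut S) (a b : A) :
    h.mulFst (BalTensor.tmul _ _ a b) = S a * b :=
  BalTensor.lift_tmul _ _ _ _

theorem mulSnd_tmul (h : 𝒜.IsBimoduleAntiAut S) (a b : A) :
    h.mulSnd (BalTensor.tmul _ _ a b) = a * S b :=
  BalTensor.lift_tmul _ _ _ _

theorem mulFst_leftMulFst (h : 𝒜.IsBimoduleAntiAut S) (c : A) (w : 𝒜.TensorBB) :
    h.mulFst (LeftTensor.mulFst _ _ c w) = S c * h.mulFst w := by
  induction w using BalTensor.induction_on with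
  | tmul a b => rw [LeftTensor.mulFst_tmul, mulFst_tmul, mulFst_tmul, h.map_mul, mul_assoc]
  | add w w' e e' => simp only [map_add, e, e', mul_add]

theorem mulFst_leftMulSnd (h : 𝒜.IsBimoduleAntiAut S) (c : A) (w : 𝒜.TensorBB) :
    h.mulFst (LeftTensor.mulSnd _ _ c w) = h.mulFst w * c := by
  induction w using BalTensor.induction_on with
  | tmul a b => rw [LeftTensor.mulSnd_tmul, mulFst_tmul, mulFst_tmul, mul_assoc]
  | add w w' e e' => simp only [map_add, e, e', add_mul]

theorem mulSnd_rightMulFst (h : 𝒜.IsBimoduleAntiAut S) (c : A) (w : 𝒜.TensorCC) :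
    h.mulSnd (RightTensor.mulFst _ _ c w) = c * h.mulSnd w := by
  induction w using BalTensor.induction_on with
  | tmul a b => rw [RightTensor.mulFst_tmul, mulSnd_tmul, mulSnd_tmul, mul_assoc]
  | add w w' e e' => simp only [map_add, e, e', mul_add]

theorem mulSnd_rightMulSnd (h : 𝒜.IsBimoduleAntiAut S) (c : A) (w : 𝒜.TensorCC) :
    h.mulSnd (RightTensor.mulSnd _ _ c w) = h.mulSnd w * S c := by
  induction w using BalTensor.induction_on with
  | tmul a b => rw [RightTensor.mulSnd_tmul, mulSnd_tmul, mulSnd_tmul, h.map_mul, mul_assoc]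
  | add w w' e e' => simp only [map_add, e, e', add_mul]

end IsBimoduleAntiAut

/-! ### Canonical maps on elementary tensors and faithfulness of `Δ_B`. -/

theorem rhoT_tmul (a b : A) :
    𝒜.rhoT (BalTensor.tmul _ _ a b) = 𝒜.isRight.preRhoT 𝒜.ΔC a b :=
  BalTensor.lift_tmul _ _ _ _

theorem lamT_tmul (a b : A) :
    𝒜.lamT (BalTensor.tmul _ _ a b) = 𝒜.isRight.preLamT 𝒜.ΔC a b :=
  BalTensor.lift_tmul _ 𝒜.isRight.preLamT_balanced _ _

theorem Tlam_tmul (a b : A) :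
    𝒜.Tlam (BalTensor.tmul _ _ a b) = 𝒜.isLeft.preTlam 𝒜.ΔB a b :=
  BalTensor.lift_tmul _ _ _ _

theorem Trho_tmul (a b : A) :
    𝒜.Trho (BalTensor.tmul _ _ a b) = 𝒜.isLeft.preTrho 𝒜.ΔB a b :=
  BalTensor.lift_tmul _ 𝒜.isLeft.preTrho_balanced _ _

/-- Bilinearity is crosswise: factors from `B` move to the second leg, factors from `C` to the first
(`ΔB_rm_C`). -/
theorem ΔB_rm_B (x : 𝒜.B) (c p q : A) :
    leftComulAction 𝒜.ΔB (rm x.1 c) (BalTensor.tmul _ _ p q) =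
      leftComulAction 𝒜.ΔB c (BalTensor.tmul _ _ p (lm x.1 q)) :=
  (LinearMap.congr_fun (𝒜.isLeft.Δ_s_right x c) _).trans
    (congrArg (leftComulAction 𝒜.ΔB c) (BalTensor.map_tmul _ _ _ _ p q))

theorem ΔB_rm_C (x : 𝒜.B) (c p q : A) :
    leftComulAction 𝒜.ΔB (rm (𝒜.SB x).1 c) (BalTensor.tmul _ _ p q) =
      leftComulAction 𝒜.ΔB c (BalTensor.tmul _ _ (lm (𝒜.SB x).1 p) q) :=
  (LinearMap.congr_fun (𝒜.isLeft.Δ_t_right x c) _).trans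
    (congrArg (leftComulAction 𝒜.ΔB c) (BalTensor.map_tmul _ _ _ _ p q))

/-- `T_ρ` intertwines left multiplication by `c ⊗ 1` with left multiplication by `Δ_B(c)`. -/
theorem Trho_idTensor_mulFst (h : 𝒜.IsBimoduleAntiAut S) (c : A) (w : 𝒜.TensorCC) :
    𝒜.Trho (h.idTensor (RightTensor.mulFst _ _ c w)) = leftComulAction 𝒜.ΔB c (𝒜.Trho (h.idTensor w)) := by
  suffices e : 𝒜.Trho ∘ₗ h.idTensor ∘ₗ RightTensor.mulFst _ _ c =
      leftComulAction 𝒜.ΔB c ∘ₗ 𝒜.Trho ∘ₗ h.idTensor from LinearMap.congr_fun e w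
  refine BalTensor.hom_ext fun a b => ?_
  change 𝒜.Trho (h.idTensor (RightTensor.mulFst _ _ c (BalTensor.tmul _ _ a b))) =
    leftComulAction 𝒜.ΔB c (𝒜.Trho (h.idTensor (BalTensor.tmul _ _ a b)))
  rw [RightTensor.mulFst_tmul, h.idTensor_tmul, h.idTensor_tmul, Trho_tmul, Trho_tmul,
    𝒜.isLeft.preTrho_mul]

/-- Transport along the bijection `T_ρ (id ⊗ S)` from `^C A ⊗ A_C`: there the action of `Δ_B(c)`
becomes left multiplication by `c ⊗ 1`, which is jointly faithful by the non-degeneracy assumption.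
-/
theorem IsRegularMultiplierHopfAlgebroid.ext_ΔB (h𝒜 : 𝒜.IsRegularMultiplierHopfAlgebroid)
    (h : 𝒜.IsBimoduleAntiAut S) {w w' : 𝒜.TensorBB}
    (e : ∀ c, leftComulAction 𝒜.ΔB c w = leftComulAction 𝒜.ΔB c w') : w = w' := by
  obtain ⟨v, rfl⟩ := h𝒜.bijective_Trho.surjective w
  obtain ⟨v', rfl⟩ := h𝒜.bijective_Trho.surjective w'
  rw [← h.idTensor_idTensorInv v, ← h.idTensor_idTensorInv v'] at e ⊢
  refine congrArg (fun z => 𝒜.Trho (h.idTensor z)) (𝒜.isRight.ext_fst fun c => ?_)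
  have e' := e c
  rw [← Trho_idTensor_mulFst, ← Trho_idTensor_mulFst] at e'
  have e'' := congrArg h.idTensorInv (h𝒜.bijective_Trho.injective e')
  rwa [h.idTensorInv_idTensor, h.idTensorInv_idTensor] at e''

/-- The trilinear map `(p, q, r) ↦ Δ_B(p)(S(r) ⊗ S(q) d)`. -/
def leftAct (𝒜 : MultiplierBialgebroid A) (S : A ≃ₗ[ℂ] A) (d : A) :
    A →ₗ[ℂ] A →ₗ[ℂ] A →ₗ[ℂ] 𝒜.TensorBB :=
  compTrilinear (leftComulAction 𝒜.ΔB)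
    ((BalTensor.mk₂ _ _).flip.compl₁₂ (LinearMap.mulRight ℂ d ∘ₗ S.toLinearMap) S.toLinearMap)

theorem leftAct_apply (d p q r : A) :
    leftAct 𝒜 S d p q r = leftComulAction 𝒜.ΔB p (BalTensor.tmul _ _ (S r) (S q * d)) := rfl

theorem leftAct_balanced (h : 𝒜.IsBimoduleAntiAut S) (d : A) (y : 𝒜.C) (p q r : A) :
    leftAct 𝒜 S d (rm (𝒜.SC y).1 p) q r = leftAct 𝒜 S d p (rm y.1 q) r := by
  rw [leftAct_apply, leftAct_apply, ΔB_rm_B, h.map_rm_C, lm_mul_right]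

/-- Here `S` turns the two factors into `S_B(S_C(y))` on the second leg and `S_C(y)` on the first,
which is a defining relation of `_B A ⊗ A^B`. -/
theorem leftAct_balanced₂ (h : 𝒜.IsBimoduleAntiAut S) (d : A) (y : 𝒜.C) (p q r : A) :
    leftAct 𝒜 S d p (rm (𝒜.SC y).1 q) r = leftAct 𝒜 S d p q (rm y.1 r) := by
  rw [leftAct_apply, leftAct_apply, h.map_rm_B, h.map_rm_C, ← lm_mul_right]
  exact congrArg (leftComulAction 𝒜.ΔB p) (BalTensor.tmul_balanced _ _ (𝒜.SC y) (S r) (S q * d)).symm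

/-! ### Antipode identities and the inversion formulas for the canonical maps. -/

namespace IsInvertibleAntipode

theorem flipBC_tmul (h : 𝒜.IsInvertibleAntipode S) (a b : A) :
    h.flipBC (BalTensor.tmul _ _ a b) = BalTensor.tmul _ _ (S b) (S a) :=
  BalTensor.lift_tmul _ _ _ _

theorem flipCB_tmul (h : 𝒜.IsInvertibleAntipode S) (a b : A) :
    h.flipCB (BalTensor.tmul _ _ a b) = BalTensor.tmul _ _ (S b) (S a) :=
  BalTensor.lift_tmul _ _ _ _

theorem flipInner_tmul (h : 𝒜.IsInvertibleAntipode S) (a b : A) :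
    h.flipInner (BalTensor.tmul _ _ a b) = BalTensor.tmul _ _ (S b) (S a) :=
  BalTensor.lift_tmul _ _ _ _

theorem flipOuter_tmul (h : 𝒜.IsInvertibleAntipode S) (a b : A) :
    h.flipOuter (BalTensor.tmul _ _ a b) = BalTensor.tmul _ _ (S b) (S a) :=
  BalTensor.lift_tmul _ _ _ _

theorem mulSnd_flipCB (h : 𝒜.IsInvertibleAntipode S) (c : A) (w : 𝒜.TensorCC) :
    LeftTensor.mulSnd _ _ (S c) (h.flipCB w) = h.flipCB (RightTensor.mulFst _ _ c w) := by
  induction w using BalTensor.induction_on with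
  | tmul a b =>
    rw [RightTensor.mulFst_tmul, flipCB_tmul, flipCB_tmul, LeftTensor.mulSnd_tmul, h.map_mul]
  | add w w' e e' => simp only [map_add, e, e']

theorem mulFst_flipCB (h : 𝒜.IsInvertibleAntipode S) (c : A) (w : 𝒜.TensorCC) :
    LeftTensor.mulFst _ _ (S c) (h.flipCB w) = h.flipCB (RightTensor.mulSnd _ _ c w) := by
  induction w using BalTensor.induction_on with
  | tmul a b =>
    rw [RightTensor.mulSnd_tmul, flipCB_tmul, flipCB_tmul, LeftTensor.mulFst_tmul, h.map_mul]
  | add w w' e e' => simp only [map_add, e, e']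

/-- `a₍₁₎ S(b a₍₂₎) = S_B(ε_B(a)) S(b)`, for the right comultiplication. -/
theorem mulSnd_preRhoT (h : 𝒜.IsInvertibleAntipode S) {εB : A →ₗ[ℂ] 𝒜.B}
    (hε : ∀ a b, h.mulSnd (𝒜.lamT (BalTensor.tmul _ _ a b)) = rm (𝒜.SB (εB b)).1 a) (a b : A) :
    h.mulSnd (𝒜.isRight.preRhoT 𝒜.ΔC a b) = lm (𝒜.SB (εB a)).1 (S b) := by
  -- Multiplying by `c` from the left turns `_ρT(a ⊗ b)` into `(1 ⊗ b) _λT(c ⊗ a)`, where the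
  -- antipode axiom applies; the factor `b` comes out as `S(b)` on the right.
  refine sub_eq_zero.1 (𝒜.isRight.nondegenerate _ fun c => ?_)
  rw [mul_sub, ← h.mulSnd_rightMulFst, 𝒜.isRight.mulFst_preRhoT, h.mulSnd_rightMulSnd,
    ← lamT_tmul, hε, mul_lm, sub_self]

/-- `S(b₍₁₎ a) b₍₂₎ = S(a) S_C(ε_C(b))`, for the left comultiplication. -/
theorem mulFst_preTlam (h : 𝒜.IsInvertibleAntipode S) {εC : A →ₗ[ℂ] 𝒜.C}
    (hε : ∀ a b, h.mulFst (𝒜.Trho (BalTensor.tmul _ _ a b)) = lm (𝒜.SC (εC a)).1 b) (a b : A) :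
    h.mulFst (𝒜.isLeft.preTlam 𝒜.ΔB a b) = rm (𝒜.SC (εC b)).1 (S a) := by
  -- Multiplying by `c` from the right yields `Δ_B(b)(a ⊗ c) = T_ρ(b ⊗ c)(a ⊗ 1)`; the factor `a`
  -- comes out as `S(a)` on the left.
  refine sub_eq_zero.1 (𝒜.isLeft.nondegenerate _ fun c => ?_)
  rw [sub_mul, ← h.mulFst_leftMulSnd, 𝒜.isLeft.mulSnd_preTlam, ← 𝒜.isLeft.mulFst_preTrho,
    h.mulFst_leftMulFst, ← Trho_tmul, hε, mul_lm, sub_self]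

/-- Contract the mixed coassociativity by `p ⊗ q ⊗ r ↦ p ⊗ q S(r)`. One side gives the left side
here, multiplied by `d ⊗ 1`. On the other, the antipode creates `S_B(ε_B(q))`, which moves across
the tensor sign, and the counit identity for `T_λ` leaves `ad ⊗ S(b)`. -/
theorem Trho_idTensor_rhoT (h : 𝒜.IsInvertibleAntipode S) (a b : A) :
    𝒜.Trho (h.idTensor (𝒜.isRight.preRhoT 𝒜.ΔC a b)) = BalTensor.tmul _ _ a (S b) := by
  obtain ⟨εB, εC, hB, hC, hεC, hεB⟩ := h.counits
  refine 𝒜.isLeft.ext_fst fun d => ?_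
  obtain ⟨u, hu⟩ := BalTensor.exists_proj (𝒜.isLeft.preTlam 𝒜.ΔB d a)
  obtain ⟨v, hv⟩ := BalTensor.exists_proj (𝒜.isRight.preRhoT 𝒜.ΔC a b)
  have key := 𝒜.coassoc_BC.lift_eq
    (M := 𝒜.TensorBB)
    (BalTensor.tmulMul _ _ S.toLinearMap)
    (fun x p q r => by
      rw [BalTensor.tmulMul_apply, BalTensor.tmulMul_apply]
      rw [← lm_mul_right]
      exact BalTensor.tmul_balanced _ _ x p _)
    (fun y p q r => by
      rw [BalTensor.tmulMul_apply, BalTensor.tmulMul_apply]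
      refine congrArg (BalTensor.tmul _ _ p) ?_
      refine Eq.trans ?_ (congrArg (q * ·) (h.map_rm_C y r)).symm
      exact (mul_lm _ _ _).symm)
    (fun r => LeftTensor.mulSnd _ _ (S r)) (fun p q r => LeftTensor.mulSnd_tmul _ _ _ _ _)
    (fun p => BalTensor.mk₂ _ _ p ∘ₗ h.mulSnd) (fun p q r =>
      congrArg (BalTensor.tmul _ _ p) (h.mulSnd_tmul q r))
    d a b u v hu hv
    (LeftTensor.mulFst _ _ d ∘ₗ 𝒜.Trho ∘ₗ h.idTensor ∘ₗ BalTensor.proj _ _)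
    ((BalTensor.mk₂ _ _).flip (S b) ∘ₗ 𝒜.isLeft.sliceSnd εB hB.map_t ∘ₗ BalTensor.proj _ _)
    (fun p q => by
      rw [𝒜.isLeft.mulSnd_preTlam, ← 𝒜.isLeft.mulFst_preTrho, ← Trho_tmul, ← h.idTensor_tmul]
      rfl)
    (fun p q => by
      refine Eq.trans ?_ (congrArg (BalTensor.tmul _ _ p) (h.mulSnd_preRhoT hεB q b)).symm
      exact BalTensor.tmul_balanced _ _ (εB q) p (S b))
  change LeftTensor.mulFst _ _ d (𝒜.Trho (h.idTensor (BalTensor.proj _ _ v))) =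
    BalTensor.tmul _ _ (𝒜.isLeft.sliceSnd εB hB.map_t (BalTensor.proj _ _ u)) (S b) at key
  rw [hv, hu, ← Tlam_tmul] at key
  refine key.trans ?_
  refine (congrArg (fun z => BalTensor.tmul _ _ z (S b)) (hB.slice_Tlam d a)).trans ?_
  exact (LeftTensor.mulFst_tmul _ _ _ _ _).symm

/-- Mirror image of `Trho_idTensor_rhoT`: the same coassociativity, contracted by `p ⊗ q ⊗ r ↦ S(p)
q ⊗ r`. The antipode now creates `S_C(ε_C(p))`, and the counit identity for `_ρT` leaves `S(a) ⊗
cb`. -/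
theorem lamT_tensorId_Tlam (h : 𝒜.IsInvertibleAntipode S) (a b : A) :
    𝒜.lamT (h.tensorId (𝒜.isLeft.preTlam 𝒜.ΔB a b)) = BalTensor.tmul _ _ (S a) b := by
  obtain ⟨εB, εC, hB, hC, hεC, hεB⟩ := h.counits
  refine 𝒜.isRight.ext_snd fun c => ?_
  obtain ⟨u, hu⟩ := BalTensor.exists_proj (𝒜.isLeft.preTlam 𝒜.ΔB a b)
  obtain ⟨v, hv⟩ := BalTensor.exists_proj (𝒜.isRight.preRhoT 𝒜.ΔC b c)
  have key := 𝒜.coassoc_BC.lift_eq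
    (M := 𝒜.TensorCC)
    (BalTensor.mulTmul _ _ S.toLinearMap)
    (fun x p q r => by
      rw [BalTensor.mulTmul_apply, BalTensor.mulTmul_apply]
      refine congrArg (BalTensor.tmul _ _ · r) ?_
      refine (congrArg (· * q) (h.map_lm_B x p)).trans ?_
      exact (mul_lm _ _ _).symm)
    (fun y p q r => by
      rw [BalTensor.mulTmul_apply, BalTensor.mulTmul_apply]
      rw [← rm_mul_left]
      exact BalTensor.tmul_balanced _ _ y _ r)
    (fun r => (BalTensor.mk₂ _ _).flip r ∘ₗ h.mulFst) (fun p q r =>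
      congrArg (BalTensor.tmul _ _ · r) (h.mulFst_tmul p q))
    (fun p => RightTensor.mulFst _ _ (S p)) (fun p q r => RightTensor.mulFst_tmul _ _ _ _ _)
    a b c u v hu hv
    (BalTensor.mk₂ _ _ (S a) ∘ₗ 𝒜.isRight.sliceFst εC hC.map_t ∘ₗ BalTensor.proj _ _)
    (RightTensor.mulSnd _ _ c ∘ₗ 𝒜.lamT ∘ₗ h.tensorId ∘ₗ BalTensor.proj _ _)
    (fun p q => by
      refine Eq.trans ?_ (congrArg (BalTensor.tmul _ _ · q) (h.mulFst_preTlam hεC a p)).symm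
      exact (BalTensor.tmul_balanced _ _ (εC p) (S a) q).symm)
    (fun p q => by
      rw [𝒜.isRight.mulFst_preRhoT, ← lamT_tmul, ← h.tensorId_tmul]
      rfl)
  change BalTensor.tmul _ _ (S a) (𝒜.isRight.sliceFst εC hC.map_t (BalTensor.proj _ _ v)) =
    RightTensor.mulSnd _ _ c (𝒜.lamT (h.tensorId (BalTensor.proj _ _ u))) at key
  rw [hv, hu, ← rhoT_tmul] at key
  refine key.symm.trans ?_
  refine (congrArg (BalTensor.tmul _ _ (S a)) (hC.slice_rhoT b c)).trans ?_
  exact (RightTensor.mulSnd_tmul _ _ _ _ _).symm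

/-! ### The identity for `T_ρ` and `_λT`. -/

/-- The map `c ⊗ b ↦ Δ_B(c) Σ(S ⊗ S)((a ⊗ 1)Δ_C(b))`. -/
def actFlip (h : 𝒜.IsInvertibleAntipode S) (a : A) : A ⊗[ℂ] A →ₗ[ℂ] 𝒜.TensorBB :=
  TensorProduct.lift
    ((leftComulAction 𝒜.ΔB).compl₂ (h.flipCB ∘ₗ 𝒜.isRight.preLamT 𝒜.ΔC a))

theorem actFlip_tmul (h : 𝒜.IsInvertibleAntipode S) (a c b : A) :
    h.actFlip a (c ⊗ₜ b) = leftComulAction 𝒜.ΔB c (h.flipCB (𝒜.isRight.preLamT 𝒜.ΔC a b)) :=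
  TensorProduct.lift.tmul _ _

-- Coassociativity of `Δ_C` is tested on `Δ_B(p)(S(r) ⊗ S(q) S(a))`. Grouping the last two legs
-- gives `actFlip`; grouping the first two lets `Trho_idTensor_rhoT` collapse them.
set_option maxHeartbeats 1000000 in
theorem actFlip_eq_of_proj_eq_lamT (h : 𝒜.IsInvertibleAntipode S) (a p q : A) (u : A ⊗[ℂ] A)
    (hu : BalTensor.proj _ _ u = 𝒜.isRight.preLamT 𝒜.ΔC p q) :
    h.actFlip a u =
      𝒜.isLeft.preTrho 𝒜.ΔB (h.mulSnd (𝒜.isRight.preLamT 𝒜.ΔC p q)) (S a) := by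
  obtain ⟨εB, εC, hB, hC, hεC, hεB⟩ := h.counits
  refine 𝒜.isLeft.ext_fst fun e' => ?_
  -- Writing the test factor as `S(e)` lets it pass through the flip as left multiplication by `1 ⊗
  -- e`.
  obtain ⟨e, rfl⟩ := S.surjective e'
  obtain ⟨v, hv⟩ := BalTensor.exists_proj (𝒜.isRight.preRhoT 𝒜.ΔC q e)
  have key := 𝒜.isRight.coassoc.lift_eq
    (M := 𝒜.TensorBB) (leftAct 𝒜 S (S a)) (leftAct_balanced h.toIsBimoduleAntiAut (S a))
    (leftAct_balanced₂ h.toIsBimoduleAntiAut (S a))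
    (fun r => LeftTensor.mulFst _ _ (S r) ∘ₗ 𝒜.Trho ∘ₗ h.idTensor ∘ₗ RightTensor.mulSnd _ _ a)
    (fun b c r => by
      change LeftTensor.mulFst _ _ (S r) (𝒜.Trho (h.idTensor (RightTensor.mulSnd _ _ a
        (BalTensor.tmul _ _ b c)))) = _
      rw [RightTensor.mulSnd_tmul, h.idTensor_tmul, Trho_tmul, 𝒜.isLeft.mulFst_preTrho,
        leftAct_apply, h.map_mul])
    (fun b => leftComulAction 𝒜.ΔB b ∘ₗ LeftTensor.mulSnd _ _ (S a) ∘ₗ h.flipCB)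
    (fun b c r => by
      change leftComulAction 𝒜.ΔB b (LeftTensor.mulSnd _ _ (S a) (h.flipCB (BalTensor.tmul _ _ c r))) = _
      rw [h.flipCB_tmul, LeftTensor.mulSnd_tmul, leftAct_apply])
    p q e u v hu hv
    (leftComulAction 𝒜.ΔB p ∘ₗ (BalTensor.mk₂ _ _).flip (S a) ∘ₗ h.mulSnd ∘ₗ BalTensor.proj _ _)
    (LeftTensor.mulFst _ _ (S e) ∘ₗ h.actFlip a)
    (fun b c => by
      change leftComulAction 𝒜.ΔB p (BalTensor.tmul _ _ (h.mulSnd (BalTensor.tmul _ _ b c)) (S a)) =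
        LeftTensor.mulFst _ _ (S c) (𝒜.Trho (h.idTensor (RightTensor.mulSnd _ _ a
          (𝒜.isRight.preLamT 𝒜.ΔC p b))))
      -- Here `(p ⊗ a)Δ_C(b)` is read as `(p ⊗ 1) _ρT(b ⊗ a)`: the factor `p` becomes the action of
      -- `Δ_B(p)`, and the inversion formula leaves `b ⊗ S(a)`.
      rw [← 𝒜.isRight.mulFst_preRhoT, Trho_idTensor_mulFst, h.Trho_idTensor_rhoT,
        ← 𝒜.isLeft.leftComulAction_mulFst, LeftTensor.mulFst_tmul, h.mulSnd_tmul])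
    (fun b c => by
      change LeftTensor.mulFst _ _ (S e) (h.actFlip a (b ⊗ₜ c)) =
        leftComulAction 𝒜.ΔB b (LeftTensor.mulSnd _ _ (S a) (h.flipCB (𝒜.isRight.preRhoT 𝒜.ΔC c e)))
      rw [h.mulSnd_flipCB, 𝒜.isRight.mulFst_preRhoT, ← h.mulFst_flipCB, 𝒜.isLeft.leftComulAction_mulFst,
        h.actFlip_tmul])
  change leftComulAction 𝒜.ΔB p (BalTensor.tmul _ _ (h.mulSnd (BalTensor.proj _ _ v)) (S a)) =
    LeftTensor.mulFst _ _ (S e) (h.actFlip a u) at key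
  -- The factor `S_B(ε_B(q))` on the first leg lies in `C`, so it can be moved into the argument of
  -- `Δ_B`. By the antipode axiom, `p S_B(ε_B(q))` is the contraction of `_λT(p ⊗ q)`.
  rw [← key, hv, h.mulSnd_preRhoT hεB, ← ΔB_rm_C, 𝒜.isLeft.mulFst_preTrho, ← lamT_tmul, hεB]

theorem actFlip_eq (h : 𝒜.IsInvertibleAntipode S) (a : A) (z : TensorInner 𝒜.C) :
    ∀ u : A ⊗[ℂ] A, BalTensor.proj _ _ u = 𝒜.lamT z →
      h.actFlip a u = 𝒜.isLeft.preTrho 𝒜.ΔB (h.mulSnd (𝒜.lamT z)) (S a) := by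
  induction z using BalTensor.induction_on with
  | tmul p q =>
    intro u hu
    rw [lamT_tmul] at hu ⊢
    exact h.actFlip_eq_of_proj_eq_lamT a p q u hu
  | add z z' hz hz' =>
    intro u hu
    obtain ⟨u', hu'⟩ := BalTensor.exists_proj (𝒜.lamT z')
    -- A representative of a sum need not come split; subtracting any representative of the second
    -- summand leaves one of the first.
    have e : BalTensor.proj _ _ (u - u') = 𝒜.lamT z := by
      rw [map_sub, hu, hu', map_add, add_sub_cancel_right]
    rw [← sub_add_cancel u u', map_add, hz _ e, hz' _ hu', map_add, map_add, map_add,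
      LinearMap.add_apply]

/-- `T_ρ ∘ Σ(S ⊗ S) = Σ(S ⊗ S) ∘ _λT`. -/
theorem preTrho_eq_flipCB (h : 𝒜.IsInvertibleAntipode S)
    (h𝒜 : 𝒜.IsRegularMultiplierHopfAlgebroid) (a b : A) :
    𝒜.isLeft.preTrho 𝒜.ΔB (S b) (S a) = h.flipCB (𝒜.isRight.preLamT 𝒜.ΔC a b) := by
  refine h𝒜.ext_ΔB h.toIsBimoduleAntiAut fun c => ?_
  -- Since `_λT` is surjective, `c ⊗ b` is an admissible representative. Its contraction is `c
  -- S(b)`, and multiplicativity of `Δ_B` splits off `Δ_B(c)`.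
  obtain ⟨z, hz⟩ := h𝒜.bijective_lamT.surjective (BalTensor.tmul _ _ c b)
  have key := h.actFlip_eq a z (c ⊗ₜ b) hz.symm
  rw [hz, h.actFlip_tmul, h.mulSnd_tmul, 𝒜.isLeft.preTrho_mul] at key
  exact key.symm

/-! ### Deduction of the identity for `_ρT` and `T_λ`. -/

theorem idTensor_flipBC (h : 𝒜.IsInvertibleAntipode S) (w : 𝒜.TensorBB) :
    h.idTensor (h.flipBC w) = h.flipInner (h.tensorId w) := by
  induction w using BalTensor.induction_on with
  | tmul a b => rw [h.flipBC_tmul, h.idTensor_tmul, h.tensorId_tmul, h.flipInner_tmul]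
  | add w w' e e' => rw [map_add, map_add, map_add, map_add, e, e']

theorem Trho_comp_flipInner (h : 𝒜.IsInvertibleAntipode S)
    (h𝒜 : 𝒜.IsRegularMultiplierHopfAlgebroid) :
    𝒜.Trho ∘ₗ h.flipInner = h.flipCB ∘ₗ 𝒜.lamT := by
  refine BalTensor.hom_ext fun a b => ?_
  rw [LinearMap.comp_apply, LinearMap.comp_apply, h.flipInner_tmul, Trho_tmul, lamT_tmul,
    h.preTrho_eq_flipCB h𝒜]

theorem rhoT_comp_flipOuter (h : 𝒜.IsInvertibleAntipode S)
    (h𝒜 : 𝒜.IsRegularMultiplierHopfAlgebroid) :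
    𝒜.rhoT ∘ₗ h.flipOuter = h.flipBC ∘ₗ 𝒜.Tlam := by
  refine BalTensor.hom_ext fun a b => ?_
  rw [LinearMap.comp_apply, LinearMap.comp_apply, h.flipOuter_tmul, rhoT_tmul, Tlam_tmul]
  -- Under the injective map `T_ρ (id ⊗ S)` both sides become `S(b) ⊗ S(S(a))`: the left by the
  -- first inversion formula, the right by moving `T_ρ` past the flip and applying the second.
  have e : 𝒜.Trho (h.idTensor (𝒜.isRight.preRhoT 𝒜.ΔC (S b) (S a))) =
      𝒜.Trho (h.idTensor (h.flipBC (𝒜.isLeft.preTlam 𝒜.ΔB a b))) := by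
    rw [h.Trho_idTensor_rhoT, h.idTensor_flipBC, ← LinearMap.comp_apply 𝒜.Trho,
      h.Trho_comp_flipInner h𝒜, LinearMap.comp_apply, h.lamT_tensorId_Tlam, h.flipCB_tmul]
  have e' := congrArg h.idTensorInv (h𝒜.bijective_Trho.injective e)
  rwa [h.idTensorInv_idTensor, h.idTensorInv_idTensor] at e'

end IsInvertibleAntipode

end MultiplierBialgebroid

end MultHopf

end

theorem mainTheorem4 {A : Type*} [NonUnitalRing A] [Module ℂ A] [IsScalarTower ℂ A A]
    [SMulCommClass ℂ A A] (𝒜 : MultHopf.MultiplierBialgebroid A)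
    (h𝒜 : 𝒜.IsRegularMultiplierHopfAlgebroid) (S : A ≃ₗ[ℂ] A) (hS : 𝒜.IsInvertibleAntipode S) :
    𝒜.rhoT ∘ₗ hS.flipOuter = hS.flipBC ∘ₗ 𝒜.Tlam ∧
      𝒜.Trho ∘ₗ hS.flipInner = hS.flipCB ∘ₗ 𝒜.lamT :=
  ⟨hS.rhoT_comp_flipOuter h𝒜, hS.Trho_comp_flipInner h𝒜⟩
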